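/- Let $f=(f_1,\dots,f_n)\in\mathbb C[X_1,\dots,X_n]^n$ be a square polynomial system, let $\xi\in\mathbb C^n$ be an isolated zero of $f$ such that $\kappa:=\dim\ker Df(\xi)>0$, and suppose that $\xi$ is deflation-one, i.e. for almost every $(B,b)\in\mathbb C^{n\times(n-\kappa+1)}\times\mathbb C^{n-\kappa+1}$ the deflated system $$\bigl(f(X),\ Df(X)\,B\mu,\ b^\top\mu-1\bigr)$$ in the variables $(X,\mu)\in\mathbb C^n\times\mathbb C^{n-\kappa+1}$ has exactly one zero of the form $(\xi,\mu)$, and the Jacobian matrix of the deflated system at that zero has full column rank. All norms are Euclidean. Call a tolerance $\tau>0$ admissible if it is smaller than every nonzero singular value of $Df(\xi)$. One step of the two-step Newton method with tolerance $\tau$ at a point $x$ is the following. Take a singular value decomposition $Df(x)=U\Sigma V^*$, $\Sigma=\mathrm{diag}(\sigma_1\ge\dots\ge\sigma_n\ge0)$. Split $U=[U_1,U_2]$ and $V=[V_1,V_2]$, where the blocks with index $1$ contain the columns $i$ with $\sigma_i>\tau$, and let $\Sigma_1$ be the diagonal matrix of the $\sigma_i>\tau$. Put $x'=x-V_1\Sigma_1^{-1}U_1^*f(x)$.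 Choose $v\in\operatorname{im}V_2$ with $\|v\|=1$, put $B'=U_2^*\,(D^2f(x')v)\,V_2$, solve $B'\delta=-U_2^*\,Df(x')\,v$, and put $x''=x'+V_2\delta$. For $\gamma>0$ call $v\in\mathbb C^n$ $\gamma$-generic if $\operatorname{dist}\bigl(D^2f(\xi)(v,w),\operatorname{im}Df(\xi)\bigr)\ge\gamma\|w\|$ for all $w\in\ker Df(\xi)$ (for $v\in\ker Df(\xi)$ this says that the smallest singular value of $\mathcal B(\xi)=\tilde U_2^*\,(D^2f(\xi)v)\,\tilde V_2$ is at least $\gamma$, where the columns of $\tilde U_2$ and $\tilde V_2$ are orthonormal bases of $(\operatorname{im}Df(\xi))^\perp$ and $\ker Df(\xi)$). Then the following hold. 1. For every $\gamma>0$ there is $C>0$ such that for every admissible $\tau$ there is $r\in(0,1)$ with the following two properties. (a) For every $x$ with $\|x-\xi\|<r$ and every singular value decomposition of $Df(x)$, exactly $\kappa$ of the $\sigma_i$ are at most $\tau$; and for every $\gamma$-generic unit vector $v\in\operatorname{im}V_2$, the matrix $B'$ is invertible and $\|x''-\xi\|\le C\|x-\xi\|^2$. (b) Every infinite sequence $x_0,x_1,x_2,\dots$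 of iterates of the method with $\|x_0-\xi\|<r$ and with $\gamma$-generic samples $v$ stays in the ball of radius $r$ about $\xi$, converges to $\xi$, and satisfies $\|x_{k+1}-\xi\|\le C\|x_k-\xi\|^2$ for all $k$; that is, the method converges quadratically. 2. For every $\eta>0$ there is $\gamma>0$ such that for every admissible $\tau$ there is $r>0$ such that, for every $x$ with $\|x-\xi\|<r$ and every singular value decomposition of $Df(x)$, a vector $v$ chosen uniformly at random on the unit sphere of $\operatorname{im}V_2$ fails to be $\gamma$-generic with probability at most $\eta$. 3. For every admissible $\tau$ there is $r>0$ such that, for every $x$ with $\|x-\xi\|<r$ and every singular value decomposition of $Df(x)$, the matrix $B'$ is invertible for almost every $v$ in the unit sphere of $\operatorname{im}V_2$. -/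

import Mathlib

open MeasureTheory Filter Topology
open scoped Matrix

noncomputable section

/-- Value of the square polynomial system `f` at `x`. -/
def sysEval {n : ℕ} (f : Fin n → MvPolynomial (Fin n) ℂ) (x : Fin n → ℂ) : Fin n → ℂ :=
  fun i => MvPolynomial.eval x (f i)

/-- Jacobian matrix `Df(x)`. -/
def sysJacobian {n : ℕ} (f : Fin n → MvPolynomial (Fin n) ℂ) (x : Fin n → ℂ) :
    Matrix (Fin n) (Fin n) ℂ :=
  Matrix.of fun i j => MvPolynomial.eval x (MvPolynomial.pderiv j (f i))

/-- The matrix `D²f(x)·v`, with entries `∑ k, ∂ₖ∂ⱼ fᵢ(x) vₖ`. -/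
def sysHessian {n : ℕ} (f : Fin n → MvPolynomial (Fin n) ℂ) (x v : Fin n → ℂ) :
    Matrix (Fin n) (Fin n) ℂ :=
  Matrix.of fun i j =>
    ∑ k, MvPolynomial.eval x (MvPolynomial.pderiv k (MvPolynomial.pderiv j (f i))) * v k

/-- The breadth `κ = dim ker Df(ξ)`. -/
def breadth {n : ℕ} (f : Fin n → MvPolynomial (Fin n) ℂ) (ξ : Fin n → ℂ) : ℕ :=
  Module.finrank ℂ (LinearMap.ker (sysJacobian f ξ).mulVecLin)

/-- `ξ` is an isolated singular zero of `f`. -/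
def IsIsolatedSingularZero {n : ℕ} (f : Fin n → MvPolynomial (Fin n) ℂ)
    (ξ : EuclideanSpace ℂ (Fin n)) : Prop :=
  sysEval f ξ = 0 ∧
  (∃ r > 0, ∀ y ∈ Metric.ball ξ r, sysEval f y = 0 → y = ξ) ∧
  0 < breadth f ξ

/-- The deflated system `(X, μ) ↦ (f(X), Df(X)·B·μ, bᵀ·μ - 1)` in the original variables `X` and
`m` additional variables `μ`. -/
def deflatedSystem {n m : ℕ} (f : Fin n → MvPolynomial (Fin n) ℂ)
    (B : Fin n → Fin m → ℂ) (b : Fin m → ℂ) (p : (Fin n → ℂ) × (Fin m → ℂ)) :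
    (Fin n → ℂ) × (Fin n → ℂ) × ℂ :=
  (sysEval f p.1, sysJacobian f p.1 *ᵥ (Matrix.of B *ᵥ p.2), b ⬝ᵥ p.2 - 1)

/-- `ξ` is a deflation-one singular zero of `f`: an isolated singular zero at which the deflation
process stops after one step, i.e. for almost every `B ∈ ℂ^{n×(n-κ+1)}` and `b ∈ ℂ^{n-κ+1}` the
deflated system has exactly one zero `(ξ, μ)` over `ξ`, and this zero is regular (the Jacobian of
the deflated system there has full column rank). -/
def IsDeflationOneSingularZero {n : ℕ} (f : Fin n → MvPolynomial (Fin n) ℂ)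
    (ξ : EuclideanSpace ℂ (Fin n)) : Prop :=
  IsIsolatedSingularZero f ξ ∧
  ∀ᵐ Bb : (Fin n → Fin (n - breadth f ξ + 1) → ℂ) × (Fin (n - breadth f ξ + 1) → ℂ),
    ∃ μ : Fin (n - breadth f ξ + 1) → ℂ,
      deflatedSystem f Bb.1 Bb.2 (ξ, μ) = 0 ∧
      (∀ μ', deflatedSystem f Bb.1 Bb.2 (ξ, μ') = 0 → μ' = μ) ∧
      Function.Injective (fderiv ℂ (deflatedSystem f Bb.1 Bb.2) (ξ, μ))

/-- `A = U·diag(σ)·V*` is a singular value decomposition, `σ₁ ≥ ⋯ ≥ σₙ ≥ 0`. -/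
def IsSVD {n : ℕ} (A U : Matrix (Fin n) (Fin n) ℂ) (σ : Fin n → ℝ)
    (V : Matrix (Fin n) (Fin n) ℂ) : Prop :=
  U ∈ Matrix.unitaryGroup (Fin n) ℂ ∧ V ∈ Matrix.unitaryGroup (Fin n) ℂ ∧
  Antitone σ ∧ (∀ i, 0 ≤ σ i) ∧
  A = U * Matrix.diagonal (fun i => (σ i : ℂ)) * Vᴴ

/-- Indices of the singular values exceeding the tolerance (an initial segment of `Fin n`). -/
abbrev LeadIdx {n : ℕ} (τ : ℝ) (σ : Fin n → ℝ) : Type := {i : Fin n // τ < σ i}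

/-- Indices of the remaining singular values (a final segment of `Fin n`). -/
abbrev TailIdx {n : ℕ} (τ : ℝ) (σ : Fin n → ℝ) : Type := {i : Fin n // σ i ≤ τ}

/-- The block `M₁` of `M = [M₁, M₂]`. -/
def leadBlock {n : ℕ} (τ : ℝ) (σ : Fin n → ℝ) (M : Matrix (Fin n) (Fin n) ℂ) :
    Matrix (Fin n) (LeadIdx τ σ) ℂ :=
  M.submatrix id Subtype.val

/-- The block `M₂` of `M = [M₁, M₂]`. -/
def tailBlock {n : ℕ} (τ : ℝ) (σ : Fin n → ℝ) (M : Matrix (Fin n) (Fin n) ℂ) :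
    Matrix (Fin n) (TailIdx τ σ) ℂ :=
  M.submatrix id Subtype.val

/-- The first refinement `x' = x - V₁·Σ₁⁻¹·U₁*·f(x)`. -/
def firstRefinement {n : ℕ} (f : Fin n → MvPolynomial (Fin n) ℂ) (τ : ℝ)
    (U : Matrix (Fin n) (Fin n) ℂ) (σ : Fin n → ℝ) (V : Matrix (Fin n) (Fin n) ℂ)
    (x : EuclideanSpace ℂ (Fin n)) : EuclideanSpace ℂ (Fin n) :=
  x - WithLp.toLp 2 ((leadBlock τ σ V *
    (Matrix.diagonal fun i : LeadIdx τ σ => (σ i : ℂ))⁻¹ * (leadBlock τ σ U)ᴴ) *ᵥ sysEval f x)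

/-- The vector `v = V₂·z`. -/
def sampleVec {n : ℕ} (τ : ℝ) (σ : Fin n → ℝ) (V : Matrix (Fin n) (Fin n) ℂ)
    (z : EuclideanSpace ℂ (TailIdx τ σ)) : Fin n → ℂ :=
  tailBlock τ σ V *ᵥ z

/-- The matrix `B' = U₂*·D²f(x')·v·V₂` with `v = V₂·z`. -/
def stepMatrix {n : ℕ} (f : Fin n → MvPolynomial (Fin n) ℂ) (τ : ℝ)
    (U : Matrix (Fin n) (Fin n) ℂ) (σ : Fin n → ℝ) (V : Matrix (Fin n) (Fin n) ℂ)
    (x : EuclideanSpace ℂ (Fin n)) (z : EuclideanSpace ℂ (TailIdx τ σ)) :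
    Matrix (TailIdx τ σ) (TailIdx τ σ) ℂ :=
  (tailBlock τ σ U)ᴴ * sysHessian f (firstRefinement f τ U σ V x) (sampleVec τ σ V z) *
    tailBlock τ σ V

/-- `x''` is an output of the two-step Newton method at `x`, for the decomposition `U, σ, V` of
`Df(x)` and the sample `v = V₂·z`: `x'' = x' + V₂·δ`, where `B'·δ = -U₂*·Df(x')·v`. -/
def IsTwoStepOutput {n : ℕ} (f : Fin n → MvPolynomial (Fin n) ℂ) (τ : ℝ)
    (U : Matrix (Fin n) (Fin n) ℂ) (σ : Fin n → ℝ) (V : Matrix (Fin n) (Fin n) ℂ)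
    (x : EuclideanSpace ℂ (Fin n)) (z : EuclideanSpace ℂ (TailIdx τ σ))
    (x'' : EuclideanSpace ℂ (Fin n)) : Prop :=
  ∃ δ : TailIdx τ σ → ℂ,
    stepMatrix f τ U σ V x z *ᵥ δ =
      -((tailBlock τ σ U)ᴴ *ᵥ
        (sysJacobian f (firstRefinement f τ U σ V x) *ᵥ sampleVec τ σ V z)) ∧
    x'' = firstRefinement f τ U σ V x + WithLp.toLp 2 (tailBlock τ σ V *ᵥ δ)

/-- The smallest singular value of the compression of `D²f(ξ)·v` to a map from `ker Df(ξ)` to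
`(im Df(ξ))ᗮ` (in orthonormal bases: of the matrix `Ũ₂*·D²f(ξ)·v·Ṽ₂` formed with a singular value
decomposition of `Df(ξ)`) is at least `γ`. The distance of a vector to `im Df(ξ)` is the norm of
its projection to `(im Df(ξ))ᗮ`. -/
def IsGenericAtLevel {n : ℕ} (f : Fin n → MvPolynomial (Fin n) ℂ) (ξ : Fin n → ℂ) (γ : ℝ)
    (v : Fin n → ℂ) : Prop :=
  ∀ w u : Fin n → ℂ, sysJacobian f ξ *ᵥ w = 0 →
    γ * ‖WithLp.toLp 2 w‖ ≤ ‖WithLp.toLp 2 (sysHessian f ξ v *ᵥ w - sysJacobian f ξ *ᵥ u)‖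

/-- One step `x ↦ x''` of the two-step Newton method with tolerance `τ`, for some singular value
decomposition of `Df(x)` and some unit sample `v` in the image of `V₂` satisfying `P v`. -/
def TwoStepNewton {n : ℕ} (f : Fin n → MvPolynomial (Fin n) ℂ) (τ : ℝ)
    (P : (Fin n → ℂ) → Prop) (x x'' : EuclideanSpace ℂ (Fin n)) : Prop :=
  ∃ U σ V, IsSVD (sysJacobian f x) U σ V ∧
    ∃ z : EuclideanSpace ℂ (TailIdx τ σ), ‖z‖ = 1 ∧ P (sampleVec τ σ V z) ∧
      IsTwoStepOutput f τ U σ V x z x''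

/-- The tolerance `τ` is positive and smaller than every nonzero singular value of `Df(ξ)`. -/
def IsAdmissibleTolerance {n : ℕ} (f : Fin n → MvPolynomial (Fin n) ℂ) (ξ : Fin n → ℂ)
    (τ : ℝ) : Prop :=
  0 < τ ∧ ∀ i, (Matrix.toEuclideanLin (sysJacobian f ξ)).singularValues i ≠ 0 →
    τ < (Matrix.toEuclideanLin (sysJacobian f ξ)).singularValues i

/-- The (unnormalized) uniform measure on the unit sphere of `ℂ^J`. -/
def sphereMeasure (J : Type) [Fintype J] :
    Measure (Metric.sphere (0 : EuclideanSpace ℂ J) 1) :=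
  (volume : Measure (EuclideanSpace ℂ J)).toSphere

end

/-! Write `A₀ = Df(ξ)`, `H = D²f(ξ)` and `e = ‖x - ξ‖`. Near `ξ` the singular values of `Df(x)`
split into `κ` values that are `O(e)` and `n - κ` values bounded away from zero. The truncated
Newton step removes the error along the leading singular vectors, so `x' - ξ = V₂a + O(e²)` with `a
= V₂*(x - ξ)`. Expanding `Df` at `x'` and compressing gives `B'(δ + a) = -U₂* A₀ v + O(e²)`. The
remaining term is `O(e²)` as well: `im V₂` is `O(e)`-close to `ker A₀`, and `U₂* A₀` is itself
`O(e)`. For a `γ`-generic `v` the matrix `B'` is bounded below by `γ/2`, hence `δ + a = O(e²)` and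
`x'' - ξ = O(e²)`. The lemmas are `norm_U'_kernel_V`, `norm_le_of_genericVector` and
`norm_twoStep_le`; `IsSVD.truncatedSplitting` feeds them. The tolerance affects only the radius,
because the leading singular values have a lower bound that does not involve `τ`.

For the probability bound, deflation-one yields one `v₀` in `ker A₀` for which the compression of `H
v₀` from `ker A₀` to `(im A₀)ᗮ` is injective (`exists_kernel_vector`). The compression is linear in
`v` and square, so injectivity at `v₀` forces it at almost every kernel vector
(`ContinuousLinearMap.ae_injective`), and the vectors failing level `γ` have volume tending to zero
with `γ`. Orthogonal projection `im V₂ → ker A₀` is nearly isometric and carries this bound to the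
samples. In particular some sample is generic; its `B'` is invertible, and linearity of `B'` in `v`
gives invertibility for almost every sample. -/

noncomputable section

/-! ### Taylor estimates with a moving base point -/

section Taylor

variable {E G : Type*} [NormedAddCommGroup E] [NormedSpace ℂ E]
  [NormedAddCommGroup G] [NormedSpace ℂ G]

/-- A map of class `C¹` is Lipschitz at a point. -/
theorem ContDiff.exists_norm_sub_le {F : E → G} (hF : ContDiff ℂ 1 F) (ξ : E) :
    ∃ L : ℝ, 0 ≤ L ∧ ∀ᶠ x in 𝓝 ξ, ‖F x - F ξ‖ ≤ L * ‖x - ξ‖ := by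
  obtain ⟨K, t, ht, hK⟩ := (hF.contDiffAt (x := ξ)).exists_lipschitzOnWith
  refine ⟨K, K.2, ?_⟩
  filter_upwards [ht] with x hx
  simpa [dist_eq_norm] using hK.dist_le_mul x hx ξ (mem_of_mem_nhds ht)

/-- First-order Taylor expansion at a variable base point, with quadratic remainder. -/
theorem ContDiff.exists_norm_taylor_le {F : E → G} (hF : ContDiff ℂ 2 F) (ξ : E) :
    ∃ L : ℝ, 0 ≤ L ∧
      ∀ᶠ x in 𝓝 ξ, ‖F x - F ξ - fderiv ℂ F x (x - ξ)‖ ≤ L * ‖x - ξ‖ ^ 2 := by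
  let _ : NormedSpace ℝ E := NormedSpace.restrictScalars ℝ ℂ E
  have hA : ContDiff ℂ 1 (fderiv ℂ F) := hF.fderiv_right (by norm_num)
  obtain ⟨K, t, ht, hK⟩ := (hA.contDiffAt (x := ξ)).exists_lipschitzOnWith
  obtain ⟨ρ, hρ, hρt⟩ := Metric.mem_nhds_iff.1 ht
  -- The expansion is based at `x`, and points of the closed ball about `ξ` through `x` can be `2‖x
  -- - ξ‖` away from `x`; hence the factor 2.
  refine ⟨2 * K, by positivity, ?_⟩
  filter_upwards [Metric.ball_mem_nhds ξ hρ] with x hx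
  have hsub : Metric.closedBall ξ ‖x - ξ‖ ⊆ t := by
    intro z hz
    apply hρt
    rw [Metric.mem_closedBall] at hz
    rw [Metric.mem_ball] at hx ⊢
    rw [← dist_eq_norm] at hz
    linarith
  have hx' : x ∈ Metric.closedBall ξ ‖x - ξ‖ := by simp [dist_eq_norm]
  have := Convex.norm_image_sub_le_of_norm_fderiv_le' (𝕜 := ℂ) (f := F) (C := 2 * K * ‖x - ξ‖)
    (s := Metric.closedBall ξ ‖x - ξ‖) (x := ξ) (y := x) (φ := fderiv ℂ F x)
    (fun z _ => (hF.differentiable (by norm_num)) z)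
    (fun z hz => by
      have h1 := hK.dist_le_mul z (hsub hz) x (hsub hx')
      have h2 : Dist.dist z x ≤ 2 * ‖x - ξ‖ := by
        have := dist_triangle_right z x ξ
        rw [Metric.mem_closedBall] at hz hx'
        linarith
      rw [← dist_eq_norm]
      nlinarith [K.2])
    (convex_closedBall _ _) (by simp) hx'
  calc _ ≤ _ := this
    _ = _ := by ring

/-- Bounds for the second-order Taylor expansions of a map and of its derivative on a ball. -/
structure TaylorBound (F : E → G) (ξ : E) (L ρ : ℝ) : Prop where
  one_le : 1 ≤ L
  pos : 0 < ρ
  le_one : ρ ≤ 1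
  val : ∀ x ∈ Metric.ball ξ ρ, ‖F x - F ξ - fderiv ℂ F x (x - ξ)‖ ≤ L * ‖x - ξ‖ ^ 2
  jac : ∀ x ∈ Metric.ball ξ ρ, ‖fderiv ℂ F x - fderiv ℂ F ξ‖ ≤ L * ‖x - ξ‖
  jac_taylor : ∀ x ∈ Metric.ball ξ ρ, ∀ v,
    ‖fderiv ℂ F x v - fderiv ℂ F ξ v - fderiv ℂ (fderiv ℂ F) x v (x - ξ)‖ ≤
      L * ‖x - ξ‖ ^ 2 * ‖v‖
  hess : ∀ x ∈ Metric.ball ξ ρ,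
    ‖fderiv ℂ (fderiv ℂ F) x - fderiv ℂ (fderiv ℂ F) ξ‖ ≤ L * ‖x - ξ‖
  norm_hess : ∀ x ∈ Metric.ball ξ ρ, ‖fderiv ℂ (fderiv ℂ F) x‖ ≤ L

theorem ContDiff.exists_taylorBound {F : E → G} (hF : ContDiff ℂ 3 F) (ξ : E) :
    ∃ L ρ : ℝ, TaylorBound F ξ L ρ := by
  have hA : ContDiff ℂ 2 (fderiv ℂ F) := hF.fderiv_right (by norm_num)
  have hH : ContDiff ℂ 1 (fderiv ℂ (fderiv ℂ F)) := hA.fderiv_right (by norm_num)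
  obtain ⟨L₁, hL₁, h₁⟩ := (hF.of_le (m := 2) (by norm_num)).exists_norm_taylor_le ξ
  obtain ⟨L₂, hL₂, h₂⟩ := (hA.of_le (by norm_num)).exists_norm_sub_le ξ
  obtain ⟨L₃, hL₃, h₃⟩ := hA.exists_norm_taylor_le ξ
  obtain ⟨L₄, hL₄, h₄⟩ := hH.exists_norm_sub_le ξ
  set M := ‖fderiv ℂ (fderiv ℂ F) ξ‖
  have hM0 : 0 ≤ M := norm_nonneg (fderiv ℂ (fderiv ℂ F) ξ)
  obtain ⟨ρ, hρ, h⟩ := Metric.eventually_nhds_iff_ball.1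
    (h₁.and (h₂.and (h₃.and h₄)))
  refine ⟨1 + L₁ + L₂ + L₃ + L₄ + M, min ρ 1, by linarith, by positivity, min_le_right _ _,
    ?_, ?_, ?_, ?_, ?_⟩
  all_goals
    intro x hx
    obtain ⟨h₁, h₂, h₃, h₄⟩ := h x (Metric.ball_subset_ball (min_le_left _ _) hx)
  · refine h₁.trans ?_
    gcongr
    linarith
  · refine h₂.trans ?_
    gcongr
    linarith
  · intro v
    -- Taylor's formula for the derivative puts the increment in the first slot; symmetry moves it
    -- to the second, where the two-step argument needs it.
    have hs : fderiv ℂ (fderiv ℂ F) x v (x - ξ) = fderiv ℂ (fderiv ℂ F) x (x - ξ) v :=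
      (hF.contDiffAt.isSymmSndFDerivAt (by simp; norm_num)) v (x - ξ)
    rw [hs, ← sub_apply, ← sub_apply]
    refine (ContinuousLinearMap.le_of_opNorm_le _ h₃ v).trans ?_
    gcongr
    linarith
  · refine h₄.trans ?_
    gcongr
    linarith
  · have h1 : ‖x - ξ‖ ≤ 1 := by
      rw [Metric.mem_ball, dist_eq_norm] at hx
      exact hx.le.trans (min_le_right _ _)
    have h2 := norm_le_norm_add_norm_sub' (fderiv ℂ (fderiv ℂ F) x) (fderiv ℂ (fderiv ℂ F) ξ)
    have h3 := mul_le_mul_of_nonneg_left h1 hL₄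
    linarith

end Taylor

/-! ### Perturbation estimates for truncated splittings -/

section Splitting

variable {E W : Type*} [NormedAddCommGroup E] [InnerProductSpace ℂ E]
  [NormedAddCommGroup W] [InnerProductSpace ℂ W]

/-- The blocks of a singular value decomposition of `A`, as linear maps: `U`, `V` are the tail
blocks, `U'`, `V'` their adjoints, and `G` is the truncated pseudo-inverse. The tail singular values
are at most `ε` and the leading ones at least `g⁻¹`. -/
structure TruncatedSplitting (A : E →L[ℂ] E) (ε g : ℝ) (U V : W →ₗ[ℂ] E) (U' V' : E →ₗ[ℂ] W)
    (G : E →ₗ[ℂ] E) : Prop where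
  norm_U : ∀ z, ‖U z‖ = ‖z‖
  norm_V : ∀ z, ‖V z‖ = ‖z‖
  norm_U' : ∀ q, ‖U' q‖ ≤ ‖q‖
  norm_V' : ∀ q, ‖V' q‖ ≤ ‖q‖
  norm_G : ∀ q, ‖G q‖ ≤ g * ‖q‖
  sub_GA : ∀ y, y - G (A y) = V (V' y)
  sub_AG : ∀ q, q - A (G q) = U (U' q)
  norm_AV : ∀ z, ‖A (V z)‖ ≤ ε * ‖z‖
  norm_U'A : ∀ y, ‖U' (A y)‖ ≤ ε * ‖y‖

/-- `v` is generic at level `γ`: the composition of `H v` with the projection modulo the image of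
`A₀` is bounded below by `γ` on the kernel of `A₀`. -/
def GenericVector (A₀ : E →L[ℂ] E) (H : E →L[ℂ] E →L[ℂ] E) (γ : ℝ) (v : E) : Prop :=
  ∀ w u, A₀ w = 0 → γ * ‖w‖ ≤ ‖H v w - A₀ u‖

namespace TruncatedSplitting

variable {A A₀ : E →L[ℂ] E} {ε g : ℝ} {U V : W →ₗ[ℂ] E} {U' V' : E →ₗ[ℂ] W} {G : E →ₗ[ℂ] E}

theorem norm_kernel_V (sp : TruncatedSplitting A ε g U V U' V' G) (hA : ‖A - A₀‖ ≤ ε) (z : W) :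
    ‖A₀ (V z)‖ ≤ 2 * ε * ‖z‖ := by
  have h1 := sp.norm_AV z
  have h2 := (A - A₀).le_of_opNorm_le hA (V z)
  rw [sp.norm_V] at h2
  have h3 : A₀ (V z) = A (V z) - (A - A₀) (V z) := by simp
  rw [h3]
  refine (norm_sub_le _ _).trans ?_
  linarith

theorem norm_U'_kernel (sp : TruncatedSplitting A ε g U V U' V' G) (hA : ‖A - A₀‖ ≤ ε) (y : E) :
    ‖U' (A₀ y)‖ ≤ 2 * ε * ‖y‖ := by
  have h1 := sp.norm_U'A y
  have h2 := (sp.norm_U' ((A - A₀) y)).trans ((A - A₀).le_of_opNorm_le hA y)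
  have h3 : U' (A₀ y) = U' (A y) - U' ((A - A₀) y) := by simp
  rw [h3]
  refine (norm_sub_le _ _).trans ?_
  linarith

/-- `‖U' q‖` is almost as large as the distance of `q` to the image of `A₀`. -/
theorem exists_norm_sub_le (sp : TruncatedSplitting A ε g U V U' V' G) (hA : ‖A - A₀‖ ≤ ε)
    (q : E) : ∃ u, ‖q - A₀ u‖ ≤ ‖U' q‖ + g * ε * ‖q‖ := by
  have hε : 0 ≤ ε := (norm_nonneg _).trans hA
  -- `A (G q)` recovers `q` up to `U (U' q)`; replacing `A` by `A₀` costs `ε‖G q‖ ≤ gε‖q‖`.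
  refine ⟨G q, ?_⟩
  have h1 : q - A₀ (G q) = U (U' q) + (A - A₀) (G q) := by
    rw [← sp.sub_AG]; simp
  rw [h1]
  refine (norm_add_le _ _).trans ?_
  rw [sp.norm_U]
  have h2 := (A - A₀).le_of_opNorm_le hA (G q)
  have h3 := mul_le_mul_of_nonneg_left (sp.norm_G q) hε
  linarith

variable [FiniteDimensional ℂ E]

/-- The tail right singular vectors are close to the kernel of `A₀`. -/
theorem norm_sub_starProjection (sp : TruncatedSplitting A ε g U V U' V' G) (hA : ‖A - A₀‖ ≤ ε)
    (hg : 0 ≤ g) (hs : ∀ w ∈ (LinearMap.ker A₀.toLinearMap)ᗮ, ‖w‖ ≤ g * ‖A₀ w‖) (z : W) :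
    ‖V z - (LinearMap.ker A₀.toLinearMap).starProjection (V z)‖ ≤ 2 * g * ε * ‖z‖ := by
  have h1 := hs _ (Submodule.sub_starProjection_mem_orthogonal (V z))
  have h2 : A₀ ((LinearMap.ker A₀.toLinearMap).starProjection (V z)) = 0 :=
    Submodule.starProjection_apply_mem (LinearMap.ker A₀.toLinearMap) (V z)
  rw [map_sub, h2, sub_zero] at h1
  have h3 := mul_le_mul_of_nonneg_left (sp.norm_kernel_V hA z) hg
  linarith

/-- The compression of `A₀` to the tail blocks is of second order. -/
theorem norm_U'_kernel_V (sp : TruncatedSplitting A ε g U V U' V' G) (hA : ‖A - A₀‖ ≤ ε)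
    (hg : 0 ≤ g) (hs : ∀ w ∈ (LinearMap.ker A₀.toLinearMap)ᗮ, ‖w‖ ≤ g * ‖A₀ w‖) (z : W) :
    ‖U' (A₀ (V z))‖ ≤ 4 * g * ε ^ 2 * ‖z‖ := by
  have hε : 0 ≤ ε := (norm_nonneg _).trans hA
  have h2 : A₀ ((LinearMap.ker A₀.toLinearMap).starProjection (V z)) = 0 :=
    Submodule.starProjection_apply_mem (LinearMap.ker A₀.toLinearMap) (V z)
  -- One factor `ε` comes from the part of `V z` off the kernel, the only part `A₀` sees, and the
  -- other from `U' A₀`.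
  have h1 := sp.norm_U'_kernel hA (V z - (LinearMap.ker A₀.toLinearMap).starProjection (V z))
  rw [map_sub, h2, sub_zero] at h1
  have h3 := mul_le_mul_of_nonneg_left (sp.norm_sub_starProjection hA hg hs z)
    (by positivity : 0 ≤ 2 * ε)
  linarith

/-- The compression of `H₁ v` to the tail blocks is bounded below if `v` is generic. -/
theorem norm_le_of_genericVector (sp : TruncatedSplitting A ε g U V U' V' G) (hA : ‖A - A₀‖ ≤ ε)
    (hg : 0 ≤ g) (hs : ∀ w ∈ (LinearMap.ker A₀.toLinearMap)ᗮ, ‖w‖ ≤ g * ‖A₀ w‖)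
    {H H₁ : E →L[ℂ] E →L[ℂ] E} {L η γ : ℝ} (hH : ‖H‖ ≤ L) (hH₁ : ‖H₁ - H‖ ≤ η) (hγ : 0 ≤ γ)
    {v : E} (hv : ‖v‖ = 1) (hgen : GenericVector A₀ H γ v) (y : W) :
    (γ - (2 * γ * g * ε + 3 * g * ε * L + η)) * ‖y‖ ≤ ‖U' (H₁ v (V y))‖ := by
  have hε : 0 ≤ ε := (norm_nonneg _).trans hA
  have hL : 0 ≤ L := (norm_nonneg H).trans hH
  -- Genericity applies to kernel vectors only, so it is tested on `k`. The losses are `2γgε` from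
  -- `‖k‖` against `‖y‖`, `gεL` from `‖U' q‖` against the distance to the image, `2gεL` from
  -- replacing `k` by `V y`, and `η` from `H₁`.
  set k := (LinearMap.ker A₀.toLinearMap).starProjection (V y) with hk
  have hk0 : A₀ k = 0 := Submodule.starProjection_apply_mem (LinearMap.ker A₀.toLinearMap) (V y)
  have hVk : ‖V y - k‖ ≤ 2 * g * ε * ‖y‖ := sp.norm_sub_starProjection hA hg hs y
  have hk1 : ‖k‖ ≤ ‖y‖ := by
    have := Submodule.norm_starProjection_apply_le (LinearMap.ker A₀.toLinearMap) (V y)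
    rwa [sp.norm_V] at this
  have hk2 : (1 - 2 * g * ε) * ‖y‖ ≤ ‖k‖ := by
    have := norm_sub_norm_le (V y) k
    rw [sp.norm_V] at this
    linarith
  have hHv : ‖H v‖ ≤ L := by simpa [hv] using H.le_of_opNorm_le hH v
  have hHv₁ : ‖H₁ v - H v‖ ≤ η := by simpa [hv] using (H₁ - H).le_of_opNorm_le hH₁ v
  obtain ⟨u, hu⟩ := sp.exists_norm_sub_le hA (H v k)
  have h1 := hgen k u hk0
  have h2 : ‖H v k‖ ≤ L * ‖y‖ := ((H v).le_of_opNorm_le hHv k).trans (by gcongr)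
  have h3 : U' (H v k) = U' (H₁ v (V y)) - U' ((H₁ v - H v) (V y)) - U' (H v (V y - k)) := by
    simp
  have h4 : ‖U' ((H₁ v - H v) (V y))‖ ≤ η * ‖y‖ := by
    refine (sp.norm_U' _).trans ?_
    simpa [sp.norm_V] using (H₁ v - H v).le_of_opNorm_le hHv₁ (V y)
  have h5 : ‖U' (H v (V y - k))‖ ≤ L * (2 * g * ε * ‖y‖) :=
    (sp.norm_U' _).trans (((H v).le_of_opNorm_le hHv _).trans (by gcongr))
  have h6 : ‖U' (H v k)‖ ≤ ‖U' (H₁ v (V y))‖ + η * ‖y‖ + L * (2 * g * ε * ‖y‖) := by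
    rw [h3]
    refine (norm_sub_le _ _).trans ?_
    have := norm_sub_le (U' (H₁ v (V y))) (U' ((H₁ v - H v) (V y)))
    linarith
  have h7 : g * ε * ‖H v k‖ ≤ g * ε * (L * ‖y‖) := by gcongr
  have h8 := mul_le_mul_of_nonneg_left hk2 hγ
  nlinarith

end TruncatedSplitting

/-! ### Error analysis of the two Newton steps -/

section TwoStep

variable {F : E → E} {ξ : E} {L ρ g γ : ℝ} {U V : W →ₗ[ℂ] E} {U' V' : E →ₗ[ℂ] W} {G : E →ₗ[ℂ] E}
  {x : E}

/-- After the first refinement the error lies in the tail right singular space, up to second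
order. -/
theorem norm_firstStep_sub_le (hT : TaylorBound F ξ L ρ) (h0 : F ξ = 0) (hg : 0 ≤ g)
    (hx : x ∈ Metric.ball ξ ρ)
    (sp : TruncatedSplitting (fderiv ℂ F x) (L * ‖x - ξ‖) g U V U' V' G) :
    ‖x - G (F x) - ξ - V (V' (x - ξ))‖ ≤ g * L * ‖x - ξ‖ ^ 2 := by
  have h1 : x - G (F x) - ξ - V (V' (x - ξ)) = -G (F x - F ξ - fderiv ℂ F x (x - ξ)) := by
    rw [← sp.sub_GA, h0, sub_zero, map_sub G]; abel
  rw [h1, norm_neg]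
  refine (sp.norm_G _).trans ?_
  have := mul_le_mul_of_nonneg_left (hT.val x hx) hg
  linarith

theorem norm_firstStep_le (hT : TaylorBound F ξ L ρ) (h0 : F ξ = 0) (hg : 0 ≤ g)
    (hx : x ∈ Metric.ball ξ ρ) (hx' : g * L * ‖x - ξ‖ ≤ 1)
    (sp : TruncatedSplitting (fderiv ℂ F x) (L * ‖x - ξ‖) g U V U' V' G) :
    ‖x - G (F x) - ξ‖ ≤ 2 * ‖x - ξ‖ := by
  have h1 := norm_firstStep_sub_le hT h0 hg hx sp
  have h2 := norm_sub_norm_le (x - G (F x) - ξ) (V (V' (x - ξ)))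
  rw [sp.norm_V] at h2
  have h3 := sp.norm_V' (x - ξ)
  have h4 := mul_le_mul_of_nonneg_right hx' (norm_nonneg (x - ξ))
  nlinarith

variable [FiniteDimensional ℂ E]

/-- For a generic direction the compressed Hessian at the first refinement is bounded below. -/
theorem norm_secondStep_ge (hT : TaylorBound F ξ L ρ) (h0 : F ξ = 0) (hg : 0 ≤ g) (hγ : 0 < γ)
    (hs : ∀ w ∈ (LinearMap.ker (fderiv ℂ F ξ).toLinearMap)ᗮ, ‖w‖ ≤ g * ‖fderiv ℂ F ξ w‖)
    (hx : 2 * ‖x - ξ‖ < ρ) (hx' : g * L * ‖x - ξ‖ ≤ 1)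
    (hxγ : (2 * γ * g * L + 3 * g * L * L + 2 * L) * ‖x - ξ‖ ≤ γ / 2)
    (sp : TruncatedSplitting (fderiv ℂ F x) (L * ‖x - ξ‖) g U V U' V' G) {v : E} (hv : ‖v‖ = 1)
    (hgen : GenericVector (fderiv ℂ F ξ) (fderiv ℂ (fderiv ℂ F) ξ) γ v) (y : W) :
    γ / 2 * ‖y‖ ≤ ‖U' (fderiv ℂ (fderiv ℂ F) (x - G (F x)) v (V y))‖ := by
  have hxρ : x ∈ Metric.ball ξ ρ := by
    rw [Metric.mem_ball, dist_eq_norm]; linarith [norm_nonneg (x - ξ)]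
  have hd := norm_firstStep_le hT h0 hg hxρ hx' sp
  have hx₁ : x - G (F x) ∈ Metric.ball ξ ρ := by
    rw [Metric.mem_ball, dist_eq_norm]; linarith
  have hL := hT.one_le
  have h1 := sp.norm_le_of_genericVector (hT.jac x hxρ) hg hs
    (hT.norm_hess ξ (Metric.mem_ball_self hT.pos))
    ((hT.hess _ hx₁).trans (mul_le_mul_of_nonneg_left hd (by linarith))) hγ.le hv hgen y
  -- With `ε = L‖x - ξ‖` and `η = 2L‖x - ξ‖`, the latter since `x'` is within `2‖x - ξ‖` of `ξ`, the
  -- total loss is the left side of `hxγ`.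
  refine le_trans ?_ h1
  gcongr
  nlinarith

/-- One step of the two-step Newton method squares the error. -/
theorem norm_twoStep_le (hT : TaylorBound F ξ L ρ) (h0 : F ξ = 0) (hg : 0 ≤ g) (hγ : 0 < γ)
    (hs : ∀ w ∈ (LinearMap.ker (fderiv ℂ F ξ).toLinearMap)ᗮ, ‖w‖ ≤ g * ‖fderiv ℂ F ξ w‖)
    (hx : 2 * ‖x - ξ‖ < ρ) (hx' : g * L * ‖x - ξ‖ ≤ 1)
    (hxγ : (2 * γ * g * L + 3 * g * L * L + 2 * L) * ‖x - ξ‖ ≤ γ / 2)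
    (sp : TruncatedSplitting (fderiv ℂ F x) (L * ‖x - ξ‖) g U V U' V' G) {z δ : W} (hz : ‖z‖ = 1)
    (hgen : GenericVector (fderiv ℂ F ξ) (fderiv ℂ (fderiv ℂ F) ξ) γ (V z))
    (hδ : U' (fderiv ℂ (fderiv ℂ F) (x - G (F x)) (V z) (V δ)) =
      -U' (fderiv ℂ F (x - G (F x)) (V z))) :
    ‖x - G (F x) + V δ - ξ‖ ≤
      (g * L + 2 / γ * (g * L * L + 4 * L + 4 * g * L ^ 2)) * ‖x - ξ‖ ^ 2 := by
  have hL := hT.one_le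
  have hv : ‖V z‖ = 1 := by rw [sp.norm_V, hz]
  have hxρ : x ∈ Metric.ball ξ ρ := by
    rw [Metric.mem_ball, dist_eq_norm]; linarith [norm_nonneg (x - ξ)]
  have hd := norm_firstStep_le hT h0 hg hxρ hx' sp
  have he := norm_firstStep_sub_le hT h0 hg hxρ sp
  have hB := norm_secondStep_ge hT h0 hg hγ hs hx hx' hxγ sp hv hgen (δ + V' (x - ξ))
  set x₁ := x - G (F x) with hx₁
  set a := V' (x - ξ) with ha
  have hx₁ρ : x₁ ∈ Metric.ball ξ ρ := by
    rw [Metric.mem_ball, dist_eq_norm]; linarith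
  have hH : ‖fderiv ℂ (fderiv ℂ F) x₁ (V z)‖ ≤ L := by
    simpa [hv] using (fderiv ℂ (fderiv ℂ F) x₁).le_of_opNorm_le (hT.norm_hess x₁ hx₁ρ) (V z)
  -- The equation for `δ` cancels the first-order terms. What is left is the error of the first
  -- step, the Taylor remainder of the derivative, and the compression of `DF(ξ)`, bounded
  -- respectively by the three summands of the constant in `h5`.
  have h1 : U' (fderiv ℂ (fderiv ℂ F) x₁ (V z) (V (δ + a))) =
      -U' (fderiv ℂ (fderiv ℂ F) x₁ (V z) (x₁ - ξ - V a))
      - U' (fderiv ℂ F x₁ (V z) - fderiv ℂ F ξ (V z)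
          - fderiv ℂ (fderiv ℂ F) x₁ (V z) (x₁ - ξ))
      - U' (fderiv ℂ F ξ (V z)) := by
    rw [map_add, map_add, map_add, hδ]
    simp only [map_sub]
    abel
  have h2 : ‖U' (fderiv ℂ (fderiv ℂ F) x₁ (V z) (x₁ - ξ - V a))‖ ≤
      L * (g * L * ‖x - ξ‖ ^ 2) :=
    (sp.norm_U' _).trans ((ContinuousLinearMap.le_of_opNorm_le _ hH _).trans (by gcongr))
  have h3 : ‖U' (fderiv ℂ F x₁ (V z) - fderiv ℂ F ξ (V z)
      - fderiv ℂ (fderiv ℂ F) x₁ (V z) (x₁ - ξ))‖ ≤ L * (2 * ‖x - ξ‖) ^ 2 := by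
    refine (sp.norm_U' _).trans ((hT.jac_taylor x₁ hx₁ρ (V z)).trans ?_)
    rw [hv, mul_one]
    gcongr
  have h4 := sp.norm_U'_kernel_V (hT.jac x hxρ) hg hs z
  rw [hz, mul_one] at h4
  have h5 : ‖U' (fderiv ℂ (fderiv ℂ F) x₁ (V z) (V (δ + a)))‖ ≤
      (g * L * L + 4 * L + 4 * g * L ^ 2) * ‖x - ξ‖ ^ 2 := by
    rw [h1]
    refine (norm_sub_le _ _).trans ((add_le_add_left (norm_sub_le _ _) _).trans ?_)
    rw [norm_neg]
    nlinarith
  have h6 : ‖δ + a‖ ≤ 2 / γ * ((g * L * L + 4 * L + 4 * g * L ^ 2) * ‖x - ξ‖ ^ 2) := by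
    rw [div_mul_eq_mul_div, le_div_iff₀ hγ]
    linarith
  have h7 : x₁ + V δ - ξ = (x₁ - ξ - V a) + V (δ + a) := by
    rw [map_add]; abel
  rw [h7]
  refine (norm_add_le _ _).trans ?_
  rw [sp.norm_V]
  linarith

end TwoStep

end Splitting

/-! ### Derivatives of polynomial maps -/

section Polynomial

open MvPolynomial

variable {σ : Type*} [Fintype σ]

theorem MvPolynomial.hasFDerivAt_eval (p : MvPolynomial σ ℂ) (x : σ → ℂ) :
    HasFDerivAt (fun y : σ → ℂ => eval y p)
      (∑ j, eval x (pderiv j p) • ContinuousLinearMap.proj (R := ℂ) (φ := fun _ : σ => ℂ) j) x := by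
  classical
  induction p using MvPolynomial.induction_on with
  | C a =>
    simp only [eval_C]
    refine (hasFDerivAt_const a x).congr_fderiv ?_
    ext v
    simp
  | add p q hp hq =>
    simp only [map_add]
    refine (hp.add hq).congr_fderiv ?_
    ext v
    simp [add_mul, Finset.sum_add_distrib]
  | mul_X p i hp =>
    have hX : HasFDerivAt (fun y : σ → ℂ => y i)
        (ContinuousLinearMap.proj (R := ℂ) (φ := fun _ : σ => ℂ) i) x := hasFDerivAt_apply i x
    have := hp.mul hX
    simp only [map_mul, eval_X]
    refine this.congr_fderiv ?_
    ext v
    simp [Derivation.leibniz, pderiv_X, Pi.single_apply, apply_ite, add_mul,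
      Finset.sum_add_distrib, Finset.mul_sum, mul_assoc]

end Polynomial

/-! ### The system as a smooth map of Euclidean space -/

section System

variable {n : ℕ} (f : Fin n → MvPolynomial (Fin n) ℂ)

/-- The polynomial system as a self-map of Euclidean space. -/
def sysMap (x : EuclideanSpace ℂ (Fin n)) : EuclideanSpace ℂ (Fin n) :=
  WithLp.toLp 2 (sysEval f x)

theorem sysMap_contDiff : ContDiff ℂ 3 (sysMap f) := by
  rw [contDiff_euclidean]
  intro i
  have h1 : ContDiff ℂ 3 (fun x : Fin n → ℂ => MvPolynomial.eval x (f i)) :=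
    contDiffOn_univ.1 (AnalyticOnNhd.eval_mvPolynomial (f i)).contDiffOn_of_completeSpace
  exact h1.comp (PiLp.continuousLinearEquiv 2 ℂ (fun _ : Fin n => ℂ)).contDiff

theorem hasFDerivAt_eval_euclidean (p : MvPolynomial (Fin n) ℂ) (x : EuclideanSpace ℂ (Fin n)) :
    HasFDerivAt (fun y : EuclideanSpace ℂ (Fin n) => MvPolynomial.eval y.ofLp p)
      (∑ j, MvPolynomial.eval x.ofLp (MvPolynomial.pderiv j p) •
        (EuclideanSpace.proj j : EuclideanSpace ℂ (Fin n) →L[ℂ] ℂ)) x := by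
  have h := (MvPolynomial.hasFDerivAt_eval p x.ofLp).comp x
    (PiLp.continuousLinearEquiv 2 ℂ (fun _ : Fin n => ℂ)).hasFDerivAt
  refine h.congr_fderiv ?_
  ext v
  simp

theorem fderiv_sysMap_apply (x w : EuclideanSpace ℂ (Fin n)) :
    fderiv ℂ (sysMap f) x w = WithLp.toLp 2 (sysJacobian f x *ᵥ w) := by
  have hd : DifferentiableAt ℂ (sysMap f) x := (sysMap_contDiff f).differentiable (by norm_num) x
  ext i
  have h1 := ((EuclideanSpace.proj (𝕜 := ℂ) i).hasFDerivAt.comp x hd.hasFDerivAt).unique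
    (hasFDerivAt_eval_euclidean (f i) x)
  have h2 := DFunLike.congr_fun h1 w
  simpa [sysJacobian, Matrix.mulVec, dotProduct] using h2

theorem fderiv_fderiv_sysMap_apply (x v w : EuclideanSpace ℂ (Fin n)) :
    fderiv ℂ (fderiv ℂ (sysMap f)) x v w = WithLp.toLp 2 (sysHessian f x v *ᵥ w) := by
  have hA : ContDiff ℂ 2 (fderiv ℂ (sysMap f)) := (sysMap_contDiff f).fderiv_right (by norm_num)
  have hd : HasFDerivAt (fderiv ℂ (sysMap f)) (fderiv ℂ (fderiv ℂ (sysMap f)) x) x :=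
    (hA.differentiable (by norm_num) x).hasFDerivAt
  have hw := hd.clm_apply (hasFDerivAt_const w x)
  ext i
  have h1 : HasFDerivAt (fun y => fderiv ℂ (sysMap f) y w i)
      (∑ j, w j • ∑ k, MvPolynomial.eval x.ofLp
        (MvPolynomial.pderiv k (MvPolynomial.pderiv j (f i))) •
        (EuclideanSpace.proj k : EuclideanSpace ℂ (Fin n) →L[ℂ] ℂ)) x := by
    have h2 : (fun y => fderiv ℂ (sysMap f) y w i) = fun y : EuclideanSpace ℂ (Fin n) =>
        ∑ j, w j • MvPolynomial.eval y.ofLp (MvPolynomial.pderiv j (f i)) := by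
      ext y
      simp [fderiv_sysMap_apply, sysJacobian, Matrix.mulVec, dotProduct, mul_comm]
    rw [h2]
    exact HasFDerivAt.fun_sum fun j _ => (hasFDerivAt_eval_euclidean _ x).const_smul (w j)
  have h3 := DFunLike.congr_fun
    (((EuclideanSpace.proj (𝕜 := ℂ) i).hasFDerivAt.comp x hw).unique h1) v
  simpa [sysHessian, Matrix.mulVec, dotProduct, mul_comm] using h3

end System

/-! ### Norm bounds for isometric and diagonal matrices -/

section Isometry

variable {m k : Type*} [Fintype k] [DecidableEq k]

theorem Matrix.toEuclideanLin_mul_apply {l : Type*} [Fintype l] [DecidableEq l]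
    (M : Matrix m k ℂ) (N : Matrix k l ℂ) (z : EuclideanSpace ℂ l) :
    Matrix.toEuclideanLin (M * N) z = Matrix.toEuclideanLin M (Matrix.toEuclideanLin N z) := by
  simp [Matrix.toLpLin_apply, Matrix.mulVec_mulVec]

variable [Fintype m] [DecidableEq m]

theorem Matrix.norm_toEuclideanLin_eq {M : Matrix m k ℂ} (hM : Mᴴ * M = 1)
    (z : EuclideanSpace ℂ k) : ‖Matrix.toEuclideanLin M z‖ = ‖z‖ := by
  have h : inner ℂ (Matrix.toEuclideanLin M z) (Matrix.toEuclideanLin M z) = inner ℂ z z := by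
    rw [← LinearMap.adjoint_inner_right, ← Matrix.toEuclideanLin_conjTranspose_eq_adjoint,
      ← Matrix.toEuclideanLin_mul_apply, hM]
    simp
  rw [inner_self_eq_norm_sq_to_K, inner_self_eq_norm_sq_to_K] at h
  norm_cast at h
  exact (sq_eq_sq₀ (norm_nonneg _) (norm_nonneg _)).1 h

theorem Matrix.norm_toEuclideanLin_conjTranspose_le {M : Matrix m k ℂ} (hM : Mᴴ * M = 1)
    (q : EuclideanSpace ℂ m) : ‖Matrix.toEuclideanLin Mᴴ q‖ ≤ ‖q‖ := by
  have h : ‖Matrix.toEuclideanLin Mᴴ q‖ ^ 2 ≤ ‖Matrix.toEuclideanLin Mᴴ q‖ * ‖q‖ := by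
    rw [← inner_self_eq_norm_sq (𝕜 := ℂ)]
    conv_lhs => rw [Matrix.toEuclideanLin_conjTranspose_eq_adjoint, LinearMap.adjoint_inner_right,
      ← Matrix.toEuclideanLin_conjTranspose_eq_adjoint]
    refine (re_inner_le_norm _ _).trans ?_
    rw [Matrix.norm_toEuclideanLin_eq hM]
  by_contra! hlt
  have := norm_nonneg q
  nlinarith

theorem Matrix.norm_toEuclideanLin_diagonal_le {d : k → ℂ} {c : ℝ} (hc : 0 ≤ c)
    (hd : ∀ i, ‖d i‖ ≤ c) (z : EuclideanSpace ℂ k) :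
    ‖Matrix.toEuclideanLin (Matrix.diagonal d) z‖ ≤ c * ‖z‖ := by
  refine le_of_sq_le_sq ?_ (by positivity)
  rw [mul_pow, EuclideanSpace.norm_sq_eq, EuclideanSpace.norm_sq_eq, Finset.mul_sum]
  refine Finset.sum_le_sum fun i _ => ?_
  have h : Matrix.toEuclideanLin (Matrix.diagonal d) z i = d i * z i :=
    Matrix.mulVec_diagonal d z i
  rw [h, norm_mul, mul_pow]
  gcongr
  exact hd i

theorem Matrix.le_norm_toEuclideanLin_diagonal {d : k → ℂ} {c : ℝ} (hc : 0 ≤ c)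
    (hd : ∀ i, c ≤ ‖d i‖) (z : EuclideanSpace ℂ k) :
    c * ‖z‖ ≤ ‖Matrix.toEuclideanLin (Matrix.diagonal d) z‖ := by
  refine le_of_sq_le_sq ?_ (by positivity)
  rw [mul_pow, EuclideanSpace.norm_sq_eq, EuclideanSpace.norm_sq_eq, Finset.mul_sum]
  refine Finset.sum_le_sum fun i _ => ?_
  have h : Matrix.toEuclideanLin (Matrix.diagonal d) z i = d i * z i :=
    Matrix.mulVec_diagonal d z i
  rw [h, norm_mul, mul_pow]
  gcongr
  exact hd i

end Isometry

/-! ### Singular values under perturbation -/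

section SVD

variable {n : ℕ}

/-- The block of the columns of `M` with index satisfying `p`. -/
def colBlock (p : Fin n → Prop) (M : Matrix (Fin n) (Fin n) ℂ) : Matrix (Fin n) {i // p i} ℂ :=
  M.submatrix id Subtype.val

theorem colBlock_conjTranspose_mul_self {M : Matrix (Fin n) (Fin n) ℂ}
    (hM : M ∈ Matrix.unitaryGroup (Fin n) ℂ) (p : Fin n → Prop) [DecidablePred p] :
    (colBlock p M)ᴴ * colBlock p M = 1 := by
  have h : Mᴴ * M = 1 := Matrix.mem_unitaryGroup_iff'.1 hM
  ext i j
  have := congrFun (congrFun h i.1) j.1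
  simpa [Matrix.mul_apply, colBlock, Matrix.one_apply, Subtype.ext_iff] using this

theorem colBlock_mul_conjTranspose_add {M : Matrix (Fin n) (Fin n) ℂ}
    (hM : M ∈ Matrix.unitaryGroup (Fin n) ℂ) (τ : ℝ) (σ : Fin n → ℝ) :
    leadBlock τ σ M * (leadBlock τ σ M)ᴴ + tailBlock τ σ M * (tailBlock τ σ M)ᴴ = 1 := by
  have h : M * Mᴴ = 1 := Matrix.mem_unitaryGroup_iff.1 hM
  rw [← h]
  ext i j
  simp only [Matrix.add_apply, Matrix.mul_apply, leadBlock, tailBlock, Matrix.submatrix_apply,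
    Matrix.conjTranspose_apply, id]
  rw [← Fintype.sum_subtype_add_sum_subtype (fun l => τ < σ l) (fun l => M i l * star (M j l))]
  congr 1
  exact Fintype.sum_equiv (Equiv.subtypeEquivRight fun l => by simp) _ _ fun _ => rfl

theorem card_subtype_lt_of_imp {ι : Type*} [Fintype ι] {p q : ι → Prop} [DecidablePred p]
    [DecidablePred q] (hpq : ∀ i, p i → q i) {i : ι} (hq : q i) (hp : ¬p i) :
    Fintype.card {i // p i} < Fintype.card {i // q i} := by
  rw [Fintype.card_subtype, Fintype.card_subtype]
  refine Finset.card_lt_card (Finset.ssubset_iff_of_subset ?_ |>.2 ⟨i, by simpa, by simpa⟩)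
  exact Finset.monotone_filter_right _ fun i _ => hpq i

variable {A A₀ U V : Matrix (Fin n) (Fin n) ℂ} {σ : Fin n → ℝ}

namespace IsSVD

theorem mul_colBlock (h : IsSVD A U σ V) (p : Fin n → Prop) [DecidablePred p] :
    A * colBlock p V = colBlock p U * Matrix.diagonal (fun i : {i // p i} => (σ i : ℂ)) := by
  have hV : Vᴴ * V = 1 := Matrix.mem_unitaryGroup_iff'.1 h.2.1
  have h1 : A * V = U * Matrix.diagonal (fun i => (σ i : ℂ)) := by
    rw [h.2.2.2.2, Matrix.mul_assoc, hV, Matrix.mul_one]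
  ext i j
  have := congrFun (congrFun h1 i) j.1
  simpa [Matrix.mul_apply, colBlock, Matrix.diagonal_apply] using this

theorem conjTranspose_colBlock_mul (h : IsSVD A U σ V) (p : Fin n → Prop) [DecidablePred p] :
    (colBlock p U)ᴴ * A =
      Matrix.diagonal (fun i : {i // p i} => (σ i : ℂ)) * (colBlock p V)ᴴ := by
  have hU : Uᴴ * U = 1 := Matrix.mem_unitaryGroup_iff'.1 h.1
  have h1 : Uᴴ * A = Matrix.diagonal (fun i => (σ i : ℂ)) * Vᴴ := by
    rw [h.2.2.2.2, ← Matrix.mul_assoc, ← Matrix.mul_assoc, hU, Matrix.one_mul]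
  ext i j
  have := congrFun (congrFun h1 i.1) j
  simpa [Matrix.mul_apply, colBlock, Matrix.diagonal_apply] using this

theorem norm_apply_colBlock (h : IsSVD A U σ V) (p : Fin n → Prop) [DecidablePred p]
    (z : EuclideanSpace ℂ {i // p i}) :
    ‖Matrix.toEuclideanLin A (Matrix.toEuclideanLin (colBlock p V) z)‖ =
      ‖Matrix.toEuclideanLin (Matrix.diagonal (fun i : {i // p i} => (σ i : ℂ))) z‖ := by
  rw [← Matrix.toEuclideanLin_mul_apply, h.mul_colBlock, Matrix.toEuclideanLin_mul_apply,
    Matrix.norm_toEuclideanLin_eq (colBlock_conjTranspose_mul_self h.1 p)]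

theorem norm_singularValue (h : IsSVD A U σ V) (i : Fin n) : ‖(σ i : ℂ)‖ = σ i := by
  rw [Complex.norm_real, Real.norm_of_nonneg (h.2.2.2.1 i)]

/-- A subspace meeting the span of the selected right singular vectors trivially has dimension at
most the number of the others. -/
theorem card_add_finrank_le (h : IsSVD A U σ V) (p : Fin n → Prop) [DecidablePred p]
    (S : Submodule ℂ (EuclideanSpace ℂ (Fin n)))
    (hS : ∀ z : EuclideanSpace ℂ {i // p i}, Matrix.toEuclideanLin (colBlock p V) z ∈ S → z = 0) :
    Fintype.card {i // p i} + Module.finrank ℂ S ≤ n := by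
  have hinj : Function.Injective (Matrix.toEuclideanLin (colBlock p V)) := by
    rw [injective_iff_map_eq_zero]
    intro z hz
    have := Matrix.norm_toEuclideanLin_eq (colBlock_conjTranspose_mul_self h.2.1 p) z
    rw [hz, norm_zero] at this
    exact norm_eq_zero.1 this.symm
  have h1 := LinearMap.finrank_range_of_inj hinj
  rw [finrank_euclideanSpace] at h1
  rw [← h1]
  have := Submodule.finrank_add_finrank_le_of_disjoint
    (s := LinearMap.range (Matrix.toEuclideanLin (colBlock p V))) (t := S) ?_
  · simpa using this
  · rw [Submodule.disjoint_def]
    rintro _ ⟨z, rfl⟩ hz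
    rw [hS z hz, map_zero]

/-- The number of singular values of `A` that exceed the distance of `A` to `A₀` is at most the
rank of `A₀`. -/
theorem card_le_of_lt (h : IsSVD A U σ V) {ε c : ℝ}
    (hA : ∀ w, ‖Matrix.toEuclideanLin A w - Matrix.toEuclideanLin A₀ w‖ ≤ ε * ‖w‖) (hε : 0 ≤ ε)
    (hc : ε < c) :
    Fintype.card {i // c ≤ σ i} + Module.finrank ℂ (LinearMap.ker (Matrix.toEuclideanLin A₀)) ≤
      n := by
  -- On the selected singular vectors `A` stretches by at least `c`, while on `ker A₀` it stretches
  -- by at most `ε < c`.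
  refine h.card_add_finrank_le _ _ fun z hz => ?_
  rw [LinearMap.mem_ker] at hz
  have h1 := hA (Matrix.toEuclideanLin (colBlock (fun i => c ≤ σ i) V) z)
  rw [hz, sub_zero, h.norm_apply_colBlock,
    Matrix.norm_toEuclideanLin_eq (colBlock_conjTranspose_mul_self h.2.1 _)] at h1
  have h2 := Matrix.le_norm_toEuclideanLin_diagonal (hε.trans hc.le)
    (d := fun i : {i // c ≤ σ i} => (σ i : ℂ))
    (fun i => by rw [h.norm_singularValue]; exact i.2) z
  by_contra hz0
  have := norm_pos_iff.2 hz0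
  nlinarith

/-- The number of small singular values of `A` is at most the dimension of the kernel of `A₀`. -/
theorem card_le_finrank_ker (h : IsSVD A U σ V) {ε c s : ℝ}
    (hA : ∀ w, ‖Matrix.toEuclideanLin A w - Matrix.toEuclideanLin A₀ w‖ ≤ ε * ‖w‖)
    (hs : ∀ w ∈ (LinearMap.ker (Matrix.toEuclideanLin A₀))ᗮ,
      s * ‖w‖ ≤ ‖Matrix.toEuclideanLin A₀ w‖) (hc0 : 0 ≤ c) (hc : c + ε < s) :
    Fintype.card {i // σ i ≤ c} ≤
      Module.finrank ℂ (LinearMap.ker (Matrix.toEuclideanLin A₀)) := by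
  -- On `(ker A₀)ᗮ` the matrix `A` stretches by at least `s - ε > c`, so that complement meets the
  -- span of the small singular vectors trivially.
  have h1 := h.card_add_finrank_le (fun i => σ i ≤ c)
    (LinearMap.ker (Matrix.toEuclideanLin A₀))ᗮ fun z hz => by
      have h1 := hs _ hz
      have h3 := hA (Matrix.toEuclideanLin (colBlock (fun i => σ i ≤ c) V) z)
      have h2 := Matrix.norm_toEuclideanLin_diagonal_le hc0
        (d := fun i : {i // σ i ≤ c} => (σ i : ℂ))
        (fun i => by rw [h.norm_singularValue]; exact i.2) z
      rw [← h.norm_apply_colBlock] at h2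
      rw [Matrix.norm_toEuclideanLin_eq (colBlock_conjTranspose_mul_self h.2.1 _)] at h1 h3
      have h4 := norm_sub_norm_le (Matrix.toEuclideanLin A₀
          (Matrix.toEuclideanLin (colBlock (fun i => σ i ≤ c) V) z))
        (Matrix.toEuclideanLin A (Matrix.toEuclideanLin (colBlock (fun i => σ i ≤ c) V) z))
      rw [norm_sub_rev] at h4
      by_contra hz0
      have := norm_pos_iff.2 hz0
      nlinarith
  have h2 := Submodule.finrank_add_finrank_orthogonal (LinearMap.ker (Matrix.toEuclideanLin A₀))
  rw [finrank_euclideanSpace_fin] at h2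
  omega

variable {τ ε s g : ℝ}

/-- Near `A₀` exactly `dim ker A₀` singular values are below the tolerance. -/
theorem card_tailIdx (h : IsSVD A U σ V)
    (hA : ∀ w, ‖Matrix.toEuclideanLin A w - Matrix.toEuclideanLin A₀ w‖ ≤ ε * ‖w‖)
    (hs : ∀ w ∈ (LinearMap.ker (Matrix.toEuclideanLin A₀))ᗮ,
      s * ‖w‖ ≤ ‖Matrix.toEuclideanLin A₀ w‖) (hε : 0 ≤ ε) (hετ : ε < τ) (hτs : τ + ε < s) :
    Fintype.card (TailIdx τ σ) =
      Module.finrank ℂ (LinearMap.ker (Matrix.toEuclideanLin A₀)) := by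
  refine le_antisymm (h.card_le_finrank_ker hA hs (hε.trans hετ.le) hτs) ?_
  have h1 := h.card_le_of_lt hA hε hετ
  have h2 : Fintype.card {i // ¬ σ i ≤ τ} ≤ Fintype.card {i // τ ≤ σ i} :=
    Fintype.card_subtype_mono _ _ fun i hi => (not_le.1 hi).le
  rw [Fintype.card_subtype_compl, Fintype.card_fin] at h2
  change _ ≤ Fintype.card {i // σ i ≤ τ}
  omega

/-- The singular values below the tolerance are at most the distance of `A` to `A₀`. -/
theorem tail_le (h : IsSVD A U σ V)
    (hA : ∀ w, ‖Matrix.toEuclideanLin A w - Matrix.toEuclideanLin A₀ w‖ ≤ ε * ‖w‖)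
    (hs : ∀ w ∈ (LinearMap.ker (Matrix.toEuclideanLin A₀))ᗮ,
      s * ‖w‖ ≤ ‖Matrix.toEuclideanLin A₀ w‖) (hε : 0 ≤ ε) (hετ : ε < τ) (hτs : τ + ε < s)
    {i : Fin n} (hi : σ i ≤ τ) : σ i ≤ ε := by
  -- Such a value, together with the `n - κ` leading ones, would give more singular values above `ε`
  -- than the rank of `A₀`.
  by_contra! hlt
  have h1 := h.card_le_of_lt hA hε hlt
  have h2 := h.card_tailIdx hA hs hε hετ hτs
  have h3 : Fintype.card {j // ¬ σ j ≤ τ} < Fintype.card {j // σ i ≤ σ j} :=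
    card_subtype_lt_of_imp (fun j hj => (hi.trans_lt (not_le.1 hj)).le)
      (le_refl (σ i)) (not_not.2 hi)
  rw [Fintype.card_subtype_compl, Fintype.card_fin] at h3
  change Fintype.card {i // σ i ≤ τ} = _ at h2
  omega

/-- The singular values above the tolerance are bounded below independently of the tolerance. -/
theorem le_lead (h : IsSVD A U σ V) {s₀ : ℝ}
    (hA : ∀ w, ‖Matrix.toEuclideanLin A w - Matrix.toEuclideanLin A₀ w‖ ≤ ε * ‖w‖)
    (hs : ∀ w ∈ (LinearMap.ker (Matrix.toEuclideanLin A₀))ᗮ,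
      s * ‖w‖ ≤ ‖Matrix.toEuclideanLin A₀ w‖) (hε : 0 ≤ ε) (hετ : ε < τ) (hτs : τ + ε < s)
    (hs₀ : ∀ w ∈ (LinearMap.ker (Matrix.toEuclideanLin A₀))ᗮ,
      s₀ * ‖w‖ ≤ ‖Matrix.toEuclideanLin A₀ w‖) (hεs : ε < s₀ / 2) {i : Fin n} (hi : τ < σ i) :
    s₀ / 2 ≤ σ i := by
  -- Such a value, together with the `κ` tail ones, would exceed the kernel dimension, since `σ i +
  -- ε < s₀`. The bound `s` fixes the tail count and may depend on `τ`; `s₀` need not.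
  by_contra! hlt
  have h1 := h.card_le_finrank_ker hA hs₀ (h.2.2.2.1 i) (c := σ i)
    (by simpa using add_lt_add hlt hεs)
  have h2 := h.card_tailIdx hA hs hε hετ hτs
  have h3 : Fintype.card {j // σ j ≤ τ} < Fintype.card {j // σ j ≤ σ i} :=
    card_subtype_lt_of_imp (fun j hj => hj.trans hi.le) (le_refl (σ i)) (not_le.2 hi)
  change Fintype.card {i // σ i ≤ τ} = _ at h2
  omega

/-- Everything follows from `A Vᵢ = Uᵢ Σᵢ`, `Uᵢ* A = Σᵢ Vᵢ*` and the resolutions of the identity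
`M₁M₁* + M₂M₂* = 1`. Nonnegativity of `τ` makes `Σ₁` invertible. -/
theorem truncatedSplitting (h : IsSVD A U σ V) {A' : EuclideanSpace ℂ (Fin n) →L[ℂ] _}
    (hA' : ∀ w, A' w = Matrix.toEuclideanLin A w) (hτ : 0 ≤ τ) (hε : 0 ≤ ε) (hg : 0 < g)
    (htail : ∀ i, σ i ≤ τ → σ i ≤ ε) (hlead : ∀ i, τ < σ i → g⁻¹ ≤ σ i) :
    TruncatedSplitting A' ε g
      (Matrix.toEuclideanLin (tailBlock τ σ U)) (Matrix.toEuclideanLin (tailBlock τ σ V))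
      (Matrix.toEuclideanLin (tailBlock τ σ U)ᴴ) (Matrix.toEuclideanLin (tailBlock τ σ V)ᴴ)
      (Matrix.toEuclideanLin (leadBlock τ σ V *
        (Matrix.diagonal fun i : LeadIdx τ σ => (σ i : ℂ))⁻¹ * (leadBlock τ σ U)ᴴ)) := by
  have hU₂ : (tailBlock τ σ U)ᴴ * tailBlock τ σ U = 1 := colBlock_conjTranspose_mul_self h.1 _
  have hV₂ : (tailBlock τ σ V)ᴴ * tailBlock τ σ V = 1 := colBlock_conjTranspose_mul_self h.2.1 _
  have hU₁ : (leadBlock τ σ U)ᴴ * leadBlock τ σ U = 1 := colBlock_conjTranspose_mul_self h.1 _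
  have hV₁ : (leadBlock τ σ V)ᴴ * leadBlock τ σ V = 1 := colBlock_conjTranspose_mul_self h.2.1 _
  have hUU := colBlock_mul_conjTranspose_add h.1 τ σ
  have hVV := colBlock_mul_conjTranspose_add h.2.1 τ σ
  have hAV₁ : A * leadBlock τ σ V =
      leadBlock τ σ U * Matrix.diagonal (fun i : LeadIdx τ σ => (σ i : ℂ)) :=
    h.mul_colBlock (fun i => τ < σ i)
  have hUA₁ : (leadBlock τ σ U)ᴴ * A =
      Matrix.diagonal (fun i : LeadIdx τ σ => (σ i : ℂ)) * (leadBlock τ σ V)ᴴ :=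
    h.conjTranspose_colBlock_mul (fun i => τ < σ i)
  have hAV₂ : A * tailBlock τ σ V =
      tailBlock τ σ U * Matrix.diagonal (fun i : TailIdx τ σ => (σ i : ℂ)) :=
    h.mul_colBlock (fun i => σ i ≤ τ)
  have hUA₂ : (tailBlock τ σ U)ᴴ * A =
      Matrix.diagonal (fun i : TailIdx τ σ => (σ i : ℂ)) * (tailBlock τ σ V)ᴴ :=
    h.conjTranspose_colBlock_mul (fun i => σ i ≤ τ)
  set D : Matrix (LeadIdx τ σ) (LeadIdx τ σ) ℂ :=
    Matrix.diagonal fun i : LeadIdx τ σ => (σ i : ℂ) with hD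
  have hne : ∀ i : LeadIdx τ σ, (σ i : ℂ) ≠ 0 := fun i =>
    Complex.ofReal_ne_zero.2 (hτ.trans_lt i.2).ne'
  have hDinv : D⁻¹ = Matrix.diagonal fun i : LeadIdx τ σ => (σ i : ℂ)⁻¹ := by
    refine Matrix.inv_eq_right_inv ?_
    rw [hD, Matrix.diagonal_mul_diagonal, ← Matrix.diagonal_one]
    congr 1
    ext i
    exact mul_inv_cancel₀ (hne i)
  have hDu : IsUnit D.det := by
    rw [hD, Matrix.det_diagonal, isUnit_iff_ne_zero]
    exact Finset.prod_ne_zero_iff.2 fun i _ => hne i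
  refine ⟨Matrix.norm_toEuclideanLin_eq hU₂, Matrix.norm_toEuclideanLin_eq hV₂,
    Matrix.norm_toEuclideanLin_conjTranspose_le hU₂,
    Matrix.norm_toEuclideanLin_conjTranspose_le hV₂, fun q => ?_, fun y => ?_, fun q => ?_,
    fun z => ?_, fun y => ?_⟩
  · rw [Matrix.toEuclideanLin_mul_apply, Matrix.toEuclideanLin_mul_apply,
      Matrix.norm_toEuclideanLin_eq hV₁, hDinv]
    refine (Matrix.norm_toEuclideanLin_diagonal_le hg.le (fun i => ?_) _).trans
      (mul_le_mul_of_nonneg_left (Matrix.norm_toEuclideanLin_conjTranspose_le hU₁ q) hg.le)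
    rw [norm_inv, h.norm_singularValue]
    exact inv_le_of_inv_le₀ hg (hlead i i.2)
  · rw [hA', ← Matrix.toEuclideanLin_mul_apply, ← Matrix.toEuclideanLin_mul_apply,
      Matrix.mul_assoc, hUA₁, Matrix.mul_assoc, ← Matrix.mul_assoc D⁻¹,
      Matrix.nonsing_inv_mul D hDu,
      Matrix.one_mul, sub_eq_iff_eq_add', ← LinearMap.add_apply, ← map_add, hVV]
    simp
  · rw [hA', ← Matrix.toEuclideanLin_mul_apply, ← Matrix.toEuclideanLin_mul_apply,
      ← Matrix.mul_assoc, ← Matrix.mul_assoc, hAV₁, Matrix.mul_assoc (leadBlock τ σ U),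
      Matrix.mul_nonsing_inv D hDu,
      Matrix.mul_one, sub_eq_iff_eq_add', ← LinearMap.add_apply, ← map_add, hUU]
    simp
  · rw [hA', ← Matrix.toEuclideanLin_mul_apply, hAV₂, Matrix.toEuclideanLin_mul_apply,
      Matrix.norm_toEuclideanLin_eq hU₂]
    refine Matrix.norm_toEuclideanLin_diagonal_le hε (fun i => ?_) _
    rw [h.norm_singularValue]
    exact htail i i.2
  · rw [hA', ← Matrix.toEuclideanLin_mul_apply, hUA₂, Matrix.toEuclideanLin_mul_apply]
    refine (Matrix.norm_toEuclideanLin_diagonal_le hε (fun i => ?_) _).trans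
      (mul_le_mul_of_nonneg_left (Matrix.norm_toEuclideanLin_conjTranspose_le hV₂ y) hε)
    rw [h.norm_singularValue]
    exact htail i i.2

end IsSVD

/-- A linear map is bounded below on the orthogonal complement of its kernel, by any number that is
smaller than its nonzero singular values. -/
theorem LinearMap.exists_lt_le_norm_of_lt_singularValues {E : Type*} [NormedAddCommGroup E]
    [InnerProductSpace ℂ E] [FiniteDimensional ℂ E] (T : E →ₗ[ℂ] E) {τ : ℝ} (hτ0 : 0 ≤ τ)
    (hτ : ∀ i, T.singularValues i ≠ 0 → τ < T.singularValues i) :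
    ∃ s, τ < s ∧ ∀ w ∈ (LinearMap.ker T)ᗮ, s * ‖w‖ ≤ ‖T w‖ := by
  have hsym := T.isSymmetric_adjoint_comp_self
  have hev : ∀ᶠ s in 𝓝[>] τ, ∀ i : Fin (Module.finrank ℂ E),
      T.singularValues i ≠ 0 → s < T.singularValues i := by
    rw [eventually_all]
    intro i
    by_cases hi : T.singularValues i = 0
    · simp [hi]
    · filter_upwards [nhdsWithin_le_nhds (eventually_lt_nhds (hτ i hi))] with s hs _ using hs
  obtain ⟨s, hs, hτs⟩ := (hev.and self_mem_nhdsWithin).exists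
  have hτs : τ < s := hτs
  refine ⟨s, hτs, fun w hw => ?_⟩
  -- In an orthonormal eigenbasis of `T*T`, `‖T w‖²` is the sum of `σᵢ²|⟨bᵢ, w⟩|²`. If `σᵢ = 0` then
  -- `bᵢ` lies in the kernel and its coefficient vanishes; otherwise `σᵢ > s`.
  set b := hsym.eigenvectorBasis rfl with hb
  have happ : ∀ i, (LinearMap.adjoint T) (T (b i)) =
      ((T.singularValues i ^ 2 : ℝ) : ℂ) • b i := by
    intro i
    have := hsym.apply_eigenvectorBasis rfl i
    rw [T.sq_singularValues_fin rfl]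
    exact this
  have hnorm : ‖T w‖ ^ 2 =
      ∑ i : Fin (Module.finrank ℂ E), T.singularValues i ^ 2 * ‖inner ℂ (b i) w‖ ^ 2 := by
    have h1 : ((‖T w‖ ^ 2 : ℝ) : ℂ) = inner ℂ w ((LinearMap.adjoint T) (T w)) := by
      rw [LinearMap.adjoint_inner_right, inner_self_eq_norm_sq_to_K]; norm_cast
    have h2 : inner ℂ w ((LinearMap.adjoint T) (T w)) =
        ((∑ i : Fin (Module.finrank ℂ E),
          T.singularValues i ^ 2 * ‖inner ℂ (b i) w‖ ^ 2 : ℝ) : ℂ) := by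
      rw [← b.sum_inner_mul_inner]
      push_cast
      refine Finset.sum_congr rfl fun i _ => ?_
      rw [LinearMap.adjoint_inner_right, ← LinearMap.adjoint_inner_left, happ, inner_smul_left,
        Complex.conj_ofReal, ← inner_conj_symm w (b i), mul_left_comm, RCLike.conj_mul]
      push_cast
      rfl
    exact_mod_cast h1.trans h2
  refine le_of_sq_le_sq ?_ (norm_nonneg _)
  rw [mul_pow, hnorm, ← b.sum_sq_norm_inner_right w, Finset.mul_sum]
  refine Finset.sum_le_sum fun i _ => ?_
  by_cases hi : T.singularValues i = 0
  · have hk : b i ∈ LinearMap.ker T := by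
      rw [LinearMap.mem_ker, ← norm_eq_zero, ← sq_eq_zero_iff]
      have h1 : ((‖T (b i)‖ ^ 2 : ℝ) : ℂ) = inner ℂ (b i) ((LinearMap.adjoint T) (T (b i))) := by
        rw [LinearMap.adjoint_inner_right, inner_self_eq_norm_sq_to_K]; norm_cast
      rw [happ, hi] at h1
      simpa using h1
    rw [(Submodule.mem_orthogonal _ _).1 hw _ hk]
    simp
  · have := hs i hi
    have : s ^ 2 ≤ T.singularValues i ^ 2 := by
      have : 0 ≤ s := hτ0.trans hτs.le
      gcongr
    gcongr

end SVD

/-! ### Almost everywhere invertibility in linear families -/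

section Null

variable {E F G : Type*} [NormedAddCommGroup E] [NormedSpace ℂ E] [FiniteDimensional ℂ E]
  [MeasurableSpace E] [BorelSpace E] [NormedAddCommGroup F] [NormedSpace ℂ F]
  [FiniteDimensional ℂ F] [NormedAddCommGroup G] [NormedSpace ℂ G] [FiniteDimensional ℂ G]

/-- A linear family of linear maps between spaces of equal dimension that is invertible for one
parameter is invertible for almost every parameter. -/
theorem ContinuousLinearMap.ae_injective (N : E →L[ℂ] F →L[ℂ] G)
    (hdim : Module.finrank ℂ F = Module.finrank ℂ G) {v₀ : E} (hv₀ : Function.Injective (N v₀))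
    (μ : Measure E) [μ.IsAddHaarMeasure] : ∀ᵐ y ∂μ, Function.Injective (N y) := by
  have hopen : IsOpen {y | Function.Injective (N y)} :=
    ContinuousLinearMap.isOpen_injective.preimage N.continuous
  have : ProperSpace E := FiniteDimensional.proper ℂ E
  -- It suffices to treat each complex line `y + t v₀`: there injectivity fails only if `-t` is an
  -- eigenvalue of `(N v₀)⁻¹ N y`, so for finitely many `t`.
  refine (ae_ae_add_linearMap_mem_iff (LinearMap.toSpanSingleton ℂ E v₀) volume μ
    hopen.measurableSet).1 (Eventually.of_forall fun y => ?_)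
  set e := LinearMap.linearEquivOfInjective (N v₀).toLinearMap hv₀ hdim with he
  set T : Module.End ℂ F := e.symm.toLinearMap ∘ₗ (N y).toLinearMap with hT
  have hfin : {t : ℂ | Module.End.HasEigenvalue T (-t)}.Finite :=
    T.finite_hasEigenvalue.preimage neg_injective.injOn
  refine measure_mono_null ?_ (hfin.measure_zero volume)
  intro t ht
  by_contra hev
  refine ht ((injective_iff_map_eq_zero _).2 fun w hw => ?_)
  by_contra hw0
  refine hev (Module.End.hasEigenvalue_of_hasEigenvector (x := w)
    (Module.End.hasEigenvector_iff.2 ⟨Module.End.mem_eigenspace_iff.2 ?_, hw0⟩))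
  have hw' : N y w + t • N v₀ w = 0 := by simpa using hw
  have hNv : N v₀ w = e w := rfl
  rw [hT, LinearMap.comp_apply, LinearEquiv.coe_coe, LinearEquiv.symm_apply_eq, map_smul, neg_smul,
    ← hNv]
  exact eq_neg_of_add_eq_zero_left hw'

end Null

/-! ### From volume in space to measure on the sphere -/

section Sphere

variable {W : Type*} [NormedAddCommGroup W] [NormedSpace ℝ W] [MeasurableSpace W] [BorelSpace W]

/-- A measurable property that is invariant under radial contraction and holds almost everywhere in
space holds almost everywhere on the sphere. -/
theorem MeasureTheory.Measure.ae_toSphere {μ : Measure W} {p : W → Prop}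
    (hp : MeasurableSet {z | p z})
    (hcone : ∀ t : ℝ, 0 < t → ∀ z, p (t • z) → p z) (h : ∀ᵐ z ∂μ, p z) :
    ∀ᵐ z : Metric.sphere (0 : W) 1 ∂μ.toSphere, p z := by
  have hm : MeasurableSet {z : Metric.sphere (0 : W) 1 | p z} := measurable_subtype_coe hp
  rw [ae_iff]
  change μ.toSphere {z : Metric.sphere (0 : W) 1 | p z}ᶜ = 0
  rw [μ.toSphere_apply' hm.compl, mul_eq_zero]
  right
  refine measure_mono_null ?_ (ae_iff.1 h)
  rintro _ ⟨t, ht, _, ⟨z, hz, rfl⟩, rfl⟩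
  exact fun hpz => hz (hcone t ht.1 z hpz)

/-- Sphere measure is the dimension times the volume of the cone over the set, so a volume fraction
of the unit ball bounds a fraction of the sphere. -/
theorem MeasureTheory.Measure.toSphere_le_mul [FiniteDimensional ℝ W] {μ : Measure W}
    [μ.IsAddHaarMeasure] {s : Set (Metric.sphere (0 : W) 1)} (hs : MeasurableSet s)
    {S : Set W} {c : ENNReal} (hsS : ∀ z ∈ s, ∀ t ∈ Set.Ioo (0 : ℝ) 1, t • (z : W) ∈ S)
    (hS : μ (Metric.ball 0 1 ∩ S) ≤ c * μ (Metric.ball 0 1)) :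
    μ.toSphere s ≤ c * μ.toSphere Set.univ := by
  rw [μ.toSphere_apply' hs, μ.toSphere_apply_univ, mul_left_comm]
  gcongr
  refine (measure_mono ?_).trans hS
  rintro _ ⟨t, ht, _, ⟨z, hz, rfl⟩, rfl⟩
  refine ⟨?_, hsS z hz t ht⟩
  have h1 : ‖(z : W)‖ = 1 := norm_eq_of_mem_sphere z
  simp [norm_smul, h1, abs_of_pos ht.1, ht.2]

end Sphere

/-! ### Transport of volume bounds -/

section Transport

variable {W K : Type*} [NormedAddCommGroup W] [NormedSpace ℂ W] [FiniteDimensional ℂ W]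
  [MeasurableSpace W] [BorelSpace W] [NormedAddCommGroup K] [NormedSpace ℂ K]
  [MeasurableSpace K] [BorelSpace K]

/-- Transport of a volume bound along a linear map that is nearly an isometry. -/
theorem LinearMap.measure_ball_inter_preimage_le (T : W →ₗ[ℂ] K) (hT : Function.Surjective T)
    (hT1 : ∀ z, ‖T z‖ ≤ ‖z‖) (hT2 : ∀ z, ‖z‖ ≤ 2 * ‖T z‖) (μ : Measure W) [μ.IsAddHaarMeasure]
    (ν : Measure K) [ν.IsAddHaarMeasure] {S : Set K} (hS : MeasurableSet S) {c : ENNReal}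
    (hc : ν (Metric.ball 0 1 ∩ S) ≤ c * ν (Metric.ball 0 (1 / 2))) :
    μ (Metric.ball 0 1 ∩ T ⁻¹' S) ≤ c * μ (Metric.ball 0 1) := by
  have : ProperSpace W := FiniteDimensional.proper ℂ W
  have hTm : Measurable T := T.continuous_of_finiteDimensional.measurable
  -- The value of `a` is immaterial: it enters both sides. Radius `1/2` makes the preimage of the
  -- small ball lie in the unit ball.
  obtain ⟨a, -, ha⟩ := T.exists_map_addHaar_eq_smul_addHaar μ ν hT
  have hmap : ∀ B : Set K, MeasurableSet B → μ (T ⁻¹' B) = a * ν B := by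
    intro B hB
    rw [← Measure.map_apply hTm hB, ha, Measure.smul_apply, smul_eq_mul]
  calc μ (Metric.ball 0 1 ∩ T ⁻¹' S) ≤ μ (T ⁻¹' (Metric.ball 0 1 ∩ S)) := by
        refine measure_mono fun z hz => ⟨?_, hz.2⟩
        have h1 := mem_ball_zero_iff.1 hz.1
        exact mem_ball_zero_iff.2 ((hT1 z).trans_lt h1)
    _ = a * ν (Metric.ball 0 1 ∩ S) := hmap _ (Metric.isOpen_ball.measurableSet.inter hS)
    _ ≤ a * (c * ν (Metric.ball 0 (1 / 2))) := by gcongr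
    _ = c * μ (T ⁻¹' Metric.ball 0 (1 / 2)) := by
        rw [hmap _ Metric.isOpen_ball.measurableSet]; ring
    _ ≤ c * μ (Metric.ball 0 1) := by
        gcongr
        intro z hz
        rw [Set.mem_preimage, mem_ball_zero_iff] at hz
        rw [mem_ball_zero_iff]
        linarith [hT2 z]

end Transport

/-! ### Generic vectors and their measure -/

section Generic

variable {E W : Type*} [NormedAddCommGroup E] [InnerProductSpace ℂ E] [FiniteDimensional ℂ E]
  [NormedAddCommGroup W] [InnerProductSpace ℂ W]
  {A₀ : E →L[ℂ] E} {H : E →L[ℂ] E →L[ℂ] E} {γ : ℝ} {v v' : E}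

omit [FiniteDimensional ℂ E] in
theorem GenericVector.mono (h : GenericVector A₀ H γ v) {γ' : ℝ} (hγ : γ' ≤ γ) :
    GenericVector A₀ H γ' v := fun w u hw =>
  (mul_le_mul_of_nonneg_right hγ (norm_nonneg w)).trans (h w u hw)

omit [FiniteDimensional ℂ E] in
theorem isClosed_genericVector (A₀ : E →L[ℂ] E) (H : E →L[ℂ] E →L[ℂ] E) (γ : ℝ) :
    IsClosed {v | GenericVector A₀ H γ v} := by
  simp only [GenericVector, Set.ofPred_forall]
  refine isClosed_iInter fun w => isClosed_iInter fun u => isClosed_iInter fun _ => ?_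
  refine isClosed_le continuous_const ?_
  exact (((H.flip w).continuous).sub continuous_const).norm

omit [FiniteDimensional ℂ E] in
theorem GenericVector.smul (h : GenericVector A₀ H γ v) {t : ℂ} (ht : t ≠ 0) :
    GenericVector A₀ H (‖t‖ * γ) (t • v) := by
  intro w u hw
  have h1 := h w (t⁻¹ • u) hw
  have h2 : H (t • v) w - A₀ u = t • (H v w - A₀ (t⁻¹ • u)) := by
    simp [smul_sub, smul_smul, ht]
  rw [h2, norm_smul, mul_assoc]
  gcongr

-- Used to pass from the kernel projection of a sample to the sample itself.
omit [FiniteDimensional ℂ E] in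
theorem GenericVector.of_norm_sub_le (h : GenericVector A₀ H γ v) :
    GenericVector A₀ H (γ - ‖H‖ * ‖v' - v‖) v' := by
  intro w u hw
  have h1 := h w u hw
  have h2 : H v w - A₀ u = (H v' w - A₀ u) - H (v' - v) w := by simp
  have h3 : ‖H (v' - v) w‖ ≤ ‖H‖ * ‖v' - v‖ * ‖w‖ := H.le_opNorm₂ _ _
  have h4 := norm_sub_le (H v' w - A₀ u) (H (v' - v) w)
  rw [← h2] at h4
  linarith

/-- The compression of the bilinear map `H` to the kernel of `A₀`, modulo the image of `A₀`. -/
def kernelCompression (A₀ : E →L[ℂ] E) (H : E →L[ℂ] E →L[ℂ] E) :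
    E →L[ℂ] LinearMap.ker A₀.toLinearMap →L[ℂ] (LinearMap.range A₀.toLinearMap)ᗮ :=
  (ContinuousLinearMap.compL ℂ (LinearMap.ker A₀.toLinearMap) E
      (LinearMap.range A₀.toLinearMap)ᗮ (LinearMap.range A₀.toLinearMap)ᗮ.orthogonalProjectionOnto)
    ∘L ((ContinuousLinearMap.compL ℂ (LinearMap.ker A₀.toLinearMap) E E).flip
      (LinearMap.ker A₀.toLinearMap).subtypeL) ∘L H

theorem kernelCompression_apply (y : E) (w : LinearMap.ker A₀.toLinearMap) :
    kernelCompression A₀ H y w =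
      (LinearMap.range A₀.toLinearMap)ᗮ.orthogonalProjectionOnto (H y w) := rfl

/-- Makes the compression square, as `ContinuousLinearMap.ae_injective` requires. -/
theorem finrank_ker_eq_finrank_range_orthogonal (A₀ : E →L[ℂ] E) :
    Module.finrank ℂ (LinearMap.ker A₀.toLinearMap) =
      Module.finrank ℂ (LinearMap.range A₀.toLinearMap)ᗮ := by
  have h1 := A₀.toLinearMap.finrank_range_add_finrank_ker
  have h2 := Submodule.finrank_add_finrank_orthogonal (LinearMap.range A₀.toLinearMap)
  omega

theorem injective_kernelCompression
    (h : ∀ w u, A₀ w = 0 → H v w = A₀ u → w = 0) :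
    Function.Injective (kernelCompression A₀ H v) := by
  rw [injective_iff_map_eq_zero]
  intro w hw
  rw [kernelCompression_apply, Submodule.orthogonalProjectionOnto_eq_zero_iff,
    Submodule.orthogonal_orthogonal] at hw
  obtain ⟨u, hu⟩ := hw
  exact Subtype.ext (h w u w.2 hu.symm)

/-- In finite dimension an injective map is bounded below; the projection kills `A₀ u` and does not
increase norms, so the same bound holds for the distance to the image. -/
theorem exists_genericVector (h : Function.Injective (kernelCompression A₀ H v)) :
    ∃ γ, 0 < γ ∧ GenericVector A₀ H γ v := by
  obtain ⟨K, hK, hanti⟩ := (kernelCompression A₀ H v).toLinearMap.exists_antilipschitzWith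
    (LinearMap.ker_eq_bot.2 h)
  refine ⟨(K : ℝ)⁻¹, by positivity, fun w u hw => ?_⟩
  have h1 := hanti.le_mul_norm (map_zero _) (⟨w, hw⟩ : LinearMap.ker A₀.toLinearMap)
  have hu : (LinearMap.range A₀.toLinearMap)ᗮ.orthogonalProjectionOnto (A₀ u) = 0 := by
    rw [Submodule.orthogonalProjectionOnto_eq_zero_iff, Submodule.orthogonal_orthogonal]
    exact ⟨u, rfl⟩
  have h2 : kernelCompression A₀ H v ⟨w, hw⟩ =
      (LinearMap.range A₀.toLinearMap)ᗮ.orthogonalProjectionOnto (H v w - A₀ u) := by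
    rw [map_sub, kernelCompression_apply,
      hu, sub_zero]
  have h3 := (LinearMap.range A₀.toLinearMap)ᗮ.norm_orthogonalProjectionOnto_apply_le
    (H v w - A₀ u)
  rw [← h2] at h3
  rw [inv_mul_le_iff₀ (by positivity)]
  refine le_trans ?_ (mul_le_mul_of_nonneg_left h3 K.2)
  exact h1

variable [MeasurableSpace E] [BorelSpace E]

/-- The vectors of the kernel that are not generic at a small level have small volume. -/
theorem exists_level_measure_le {v₀ : E} (hv₀ : A₀ v₀ = 0)
    (hinj : Function.Injective (kernelCompression A₀ H v₀))
    (ν : Measure (LinearMap.ker A₀.toLinearMap)) [ν.IsAddHaarMeasure] {c : ENNReal} (hc : 0 < c) :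
    ∃ γ, 0 < γ ∧ ν (Metric.ball 0 1 ∩ {y | ¬GenericVector A₀ H γ y}) ≤ c := by
  -- Vectors failing every level `1/(m+1)` have a non-injective compression, a null set; continuity
  -- from above then makes some `s m` small.
  set s : ℕ → Set (LinearMap.ker A₀.toLinearMap) := fun m =>
    Metric.ball 0 1 ∩ {y | ¬GenericVector A₀ H (1 / ((m : ℝ) + 1)) y} with hs
  have hopen : ∀ m, IsOpen (s m) := fun m =>
    Metric.isOpen_ball.inter
      ((isClosed_genericVector A₀ H _).isOpen_compl.preimage continuous_subtype_val)
  have hanti : Antitone s := by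
    intro m k hmk y hy
    exact ⟨hy.1, fun hg => hy.2 (hg.mono (Nat.one_div_le_one_div hmk))⟩
  have hfin : ν (s 0) ≠ ⊤ :=
    ((measure_mono Set.inter_subset_left).trans_lt measure_ball_lt_top).ne
  have hlim := tendsto_measure_iInter_atTop (μ := ν)
    (fun m => (hopen m).measurableSet.nullMeasurableSet) hanti ⟨0, hfin⟩
  have hzero : ν (⋂ m, s m) = 0 := by
    have hae := ContinuousLinearMap.ae_injective
      ((kernelCompression A₀ H).comp (LinearMap.ker A₀.toLinearMap).subtypeL)
      (finrank_ker_eq_finrank_range_orthogonal A₀) (v₀ := ⟨v₀, hv₀⟩) hinj ν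
    refine measure_mono_null ?_ (ae_iff.1 hae)
    intro y hy hy'
    obtain ⟨γ, hγ, hgen⟩ := exists_genericVector hy'
    obtain ⟨m, hm⟩ := exists_nat_one_div_lt hγ
    exact (Set.mem_iInter.1 hy m).2 (hgen.mono hm.le)
  rw [hzero] at hlim
  obtain ⟨m, hm⟩ := (hlim.eventually_lt_const hc).exists
  exact ⟨1 / ((m : ℝ) + 1), Nat.one_div_pos_of_nat, hm.le⟩

omit [MeasurableSpace E] [BorelSpace E] in
theorem TruncatedSplitting.norm_orthogonalProjectionOnto_ge {A : E →L[ℂ] E} {ε g : ℝ}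
    {U V : W →ₗ[ℂ] E} {U' V' : E →ₗ[ℂ] W} {G : E →ₗ[ℂ] E}
    (sp : TruncatedSplitting A ε g U V U' V' G) (hA : ‖A - A₀‖ ≤ ε) (hg : 0 ≤ g)
    (hs : ∀ w ∈ (LinearMap.ker A₀.toLinearMap)ᗮ, ‖w‖ ≤ g * ‖A₀ w‖) (hε : 2 * g * ε ≤ 1 / 2)
    (z : W) :
    ‖z‖ ≤ 2 * ‖(LinearMap.ker A₀.toLinearMap).orthogonalProjectionOnto (V z)‖ := by
  have h1 := sp.norm_sub_starProjection hA hg hs z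
  have h2 := norm_sub_norm_le (V z) ((LinearMap.ker A₀.toLinearMap).starProjection (V z))
  have h3 : ‖(LinearMap.ker A₀.toLinearMap).starProjection (V z)‖ =
    ‖(LinearMap.ker A₀.toLinearMap).orthogonalProjectionOnto (V z)‖ := rfl
  have h4 := mul_le_mul_of_nonneg_right hε (norm_nonneg z)
  rw [sp.norm_V, h3] at h2
  linarith

-- The lower bound on the projection gives injectivity, and the dimensions agree.
omit [MeasurableSpace E] [BorelSpace E] in
theorem TruncatedSplitting.surjective_orthogonalProjectionOnto [FiniteDimensional ℂ W]
    {A : E →L[ℂ] E} {ε g : ℝ}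
    {U V : W →ₗ[ℂ] E} {U' V' : E →ₗ[ℂ] W} {G : E →ₗ[ℂ] E}
    (sp : TruncatedSplitting A ε g U V U' V' G) (hA : ‖A - A₀‖ ≤ ε) (hg : 0 ≤ g)
    (hs : ∀ w ∈ (LinearMap.ker A₀.toLinearMap)ᗮ, ‖w‖ ≤ g * ‖A₀ w‖) (hε : 2 * g * ε ≤ 1 / 2)
    (hdim : Module.finrank ℂ W = Module.finrank ℂ (LinearMap.ker A₀.toLinearMap)) :
    Function.Surjective
      ((LinearMap.ker A₀.toLinearMap).orthogonalProjectionOnto.toLinearMap ∘ₗ V) := by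
  refine (LinearMap.injective_iff_surjective_of_finrank_eq_finrank hdim).1 ?_
  rw [injective_iff_map_eq_zero]
  intro z hz
  have h1 := sp.norm_orthogonalProjectionOnto_ge hA hg hs hε z
  have h2 : (LinearMap.ker A₀.toLinearMap).orthogonalProjectionOnto (V z) = 0 := hz
  rw [h2, norm_zero, mul_zero] at h1
  exact norm_le_zero_iff.1 h1

/-- Near the singular zero, the samples that are not generic have small measure in the sphere. -/
theorem TruncatedSplitting.toSphere_not_generic_le [NormedSpace ℝ W] [FiniteDimensional ℂ W]
    [MeasurableSpace W] [BorelSpace W] [IsScalarTower ℝ ℂ W] {A : E →L[ℂ] E} {ε g : ℝ}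
    {U V : W →ₗ[ℂ] E} {U' V' : E →ₗ[ℂ] W} {G : E →ₗ[ℂ] E}
    (sp : TruncatedSplitting A ε g U V U' V' G) (hA : ‖A - A₀‖ ≤ ε) (hg : 0 ≤ g)
    (hs : ∀ w ∈ (LinearMap.ker A₀.toLinearMap)ᗮ, ‖w‖ ≤ g * ‖A₀ w‖) (hε : 2 * g * ε ≤ 1 / 2)
    (hdim : Module.finrank ℂ W = Module.finrank ℂ (LinearMap.ker A₀.toLinearMap))
    (hγ : 0 ≤ γ) (hHε : ‖H‖ * (2 * g * ε) ≤ γ)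
    (ν : Measure (LinearMap.ker A₀.toLinearMap)) [ν.IsAddHaarMeasure] {c : ENNReal}
    (hc : ν (Metric.ball 0 1 ∩ {y | ¬GenericVector A₀ H (2 * γ) y}) ≤
      c * ν (Metric.ball 0 (1 / 2)))
    (μ : Measure W) [μ.IsAddHaarMeasure] :
    μ.toSphere {z : Metric.sphere (0 : W) 1 | ¬GenericVector A₀ H γ (V z)} ≤
      c * μ.toSphere Set.univ := by
  have : FiniteDimensional ℝ W := FiniteDimensional.trans ℝ ℂ W
  have hVc : Continuous V := V.continuous_of_finiteDimensional
  have hm : MeasurableSet {z : Metric.sphere (0 : W) 1 | ¬GenericVector A₀ H γ (V z)} :=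
    ((isClosed_genericVector A₀ H γ).isOpen_compl.preimage
      (hVc.comp continuous_subtype_val)).measurableSet
  have hS : MeasurableSet {y : LinearMap.ker A₀.toLinearMap | ¬GenericVector A₀ H (2 * γ) y} :=
    ((isClosed_genericVector A₀ H (2 * γ)).isOpen_compl.preimage
      continuous_subtype_val).measurableSet
  refine Measure.toSphere_le_mul hm ?_ (LinearMap.measure_ball_inter_preimage_le
    ((LinearMap.ker A₀.toLinearMap).orthogonalProjectionOnto.toLinearMap ∘ₗ V)
    (sp.surjective_orthogonalProjectionOnto hA hg hs hε hdim)
    (fun z => ?_) (sp.norm_orthogonalProjectionOnto_ge hA hg hs hε) μ ν hS hc)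
  -- If the projection of `V (t z)` has level `2γ`, then `V (t z)` has level at least `2γ - tγ ≥
  -- tγ`, as `t < 1`; rescaling gives `V z` level `γ`.
  · intro z hz t ht hgen
    refine hz ?_
    have hz1 : ‖(z : W)‖ = 1 := norm_eq_of_mem_sphere z
    have ht0 : (t : ℂ) ≠ 0 := Complex.ofReal_ne_zero.2 ht.1.ne'
    have htz : t • (z : W) = (t : ℂ) • (z : W) := (algebraMap_smul ℂ t (z : W)).symm
    have hnt : ‖(t : ℂ)‖ = t := by rw [Complex.norm_real, Real.norm_of_nonneg ht.1.le]
    have h1 := sp.norm_sub_starProjection hA hg hs (t • (z : W))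
    have hgen : GenericVector A₀ H (2 * γ)
      ((LinearMap.ker A₀.toLinearMap).starProjection (V (t • (z : W)))) := hgen
    have h2 := hgen.of_norm_sub_le (v' := V (t • (z : W)))
    have h3 : ‖H‖ * ‖V (t • (z : W)) -
        (LinearMap.ker A₀.toLinearMap).starProjection (V (t • (z : W)))‖ ≤ t * γ := by
      rw [htz, norm_smul, hz1, hnt, mul_one] at h1
      rw [htz]
      have h4 := mul_le_mul_of_nonneg_left h1 (norm_nonneg H)
      have h5 := mul_le_mul_of_nonneg_right hHε ht.1.le
      linarith
    have h4 : GenericVector A₀ H (t * γ) (V (t • (z : W))) :=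
      h2.mono (by nlinarith [ht.1, ht.2])
    have h5 := h4.smul (inv_ne_zero ht0)
    rw [htz, map_smul, smul_smul, inv_mul_cancel₀ ht0, one_smul, norm_inv, hnt, ← mul_assoc,
      inv_mul_cancel₀ ht.1.ne', one_mul] at h5
    exact h5
  · refine ((LinearMap.ker A₀.toLinearMap).norm_orthogonalProjectionOnto_apply_le (V z)).trans ?_
    rw [sp.norm_V]

end Generic

/-! ### A generic kernel vector from the deflated system -/

section Deflation

variable {n m : ℕ} (f : Fin n → MvPolynomial (Fin n) ℂ)

theorem sysHessian_mulVec_comm (x v w : EuclideanSpace ℂ (Fin n)) :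
    sysHessian f x v *ᵥ w = sysHessian f x w *ᵥ v := by
  have h := (sysMap_contDiff f).contDiffAt.isSymmSndFDerivAt (x := x) (by simp; norm_num) v w
  rw [fderiv_fderiv_sysMap_apply, fderiv_fderiv_sysMap_apply] at h
  exact congrArg WithLp.ofLp h

/-- The derivative of the deflated system. -/
theorem exists_hasFDerivAt_deflatedSystem (B : Fin n → Fin m → ℂ) (b : Fin m → ℂ)
    (p : (Fin n → ℂ) × (Fin m → ℂ)) :
    ∃ D : (Fin n → ℂ) × (Fin m → ℂ) →L[ℂ] (Fin n → ℂ) × (Fin n → ℂ) × ℂ,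
      HasFDerivAt (deflatedSystem f B b) D p ∧
      ∀ q, D q = (sysJacobian f p.1 *ᵥ q.1,
        sysHessian f p.1 q.1 *ᵥ (Matrix.of B *ᵥ p.2) + sysJacobian f p.1 *ᵥ (Matrix.of B *ᵥ q.2),
        b ⬝ᵥ q.2) := by
  have heval : ∀ g : MvPolynomial (Fin n) ℂ,
      HasFDerivAt (fun p : (Fin n → ℂ) × (Fin m → ℂ) => MvPolynomial.eval p.1 g) _ p := fun g =>
    (MvPolynomial.hasFDerivAt_eval g p.1).comp p hasFDerivAt_fst
  set ℓ : Fin n → ((Fin n → ℂ) × (Fin m → ℂ) →L[ℂ] ℂ) := fun j =>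
    (ContinuousLinearMap.proj (R := ℂ) (φ := fun _ : Fin n => ℂ) j) ∘L
      (Matrix.of B).mulVecLin.toContinuousLinearMap ∘L ContinuousLinearMap.snd ℂ _ _ with hℓ
  have hℓ' : ∀ j, HasFDerivAt
      (fun p : (Fin n → ℂ) × (Fin m → ℂ) => (Matrix.of B *ᵥ p.2) j) (ℓ j) p :=
    fun j => (ℓ j).hasFDerivAt
  set β : (Fin n → ℂ) × (Fin m → ℂ) →L[ℂ] ℂ :=
    (dotProductBilin ℂ ℂ b).toContinuousLinearMap ∘L ContinuousLinearMap.snd ℂ _ _ with hβ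
  have hβ' : HasFDerivAt (fun p : (Fin n → ℂ) × (Fin m → ℂ) => b ⬝ᵥ p.2 - 1) β p :=
    β.hasFDerivAt.sub_const 1
  have h1 := hasFDerivAt_pi.2 fun i => heval (f i)
  have h2 := hasFDerivAt_pi.2 fun i => HasFDerivAt.fun_sum (u := Finset.univ) fun j _ =>
    (heval (MvPolynomial.pderiv j (f i))).mul (hℓ' j)
  refine ⟨_, h1.prodMk (h2.prodMk hβ'), fun q => ?_⟩
  refine Prod.ext ?_ (Prod.ext ?_ ?_)
  · ext i
    simp [sysJacobian, Matrix.mulVec, dotProduct]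
  · ext i
    simp [sysJacobian, sysHessian, Matrix.mulVec, dotProduct, hℓ, Finset.sum_add_distrib,
      -Matrix.mulVec_mulVec, add_comm, mul_comm]
  · simp [hβ]

theorem ae_volume_matrix_prod_neBot (n m : ℕ) :
    (ae (volume : Measure ((Fin n → Fin m → ℂ) × (Fin m → ℂ)))).NeBot := by
  have h1 : (volume : Measure (Fin n → Fin m → ℂ)).IsOpenPosMeasure :=
    Measure.pi.isOpenPosMeasure (fun _ : Fin n => (volume : Measure (Fin m → ℂ)))
  have h2 : (volume : Measure ((Fin n → Fin m → ℂ) × (Fin m → ℂ))).IsOpenPosMeasure :=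
    Measure.prod.instIsOpenPosMeasure
  infer_instance

/-- At a deflation-one singular zero some kernel vector is generic. -/
theorem IsDeflationOneSingularZero.exists_kernel_vector {ξ : EuclideanSpace ℂ (Fin n)}
    (hξ : IsDeflationOneSingularZero f ξ) :
    ∃ v₀ : EuclideanSpace ℂ (Fin n), fderiv ℂ (sysMap f) ξ v₀ = 0 ∧
      ∀ w u, fderiv ℂ (sysMap f) ξ w = 0 →
        fderiv ℂ (fderiv ℂ (sysMap f)) ξ v₀ w = fderiv ℂ (sysMap f) ξ u → w = 0 := by
  have := ae_volume_matrix_prod_neBot n (n - breadth f ξ + 1)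
  -- A single good pair `(B, b)` is enough; the generic vector will be `Bμ`.
  obtain ⟨⟨B, b⟩, μ, hμ, huniq, hinj⟩ := hξ.2.exists
  set J := sysJacobian f ξ with hJ
  simp only [deflatedSystem, Prod.mk_eq_zero, ← hJ] at hμ huniq
  obtain ⟨h0, hJμ, hbμ⟩ := hμ
  obtain ⟨D, hD, hDq⟩ := exists_hasFDerivAt_deflatedSystem f B b (ξ, μ)
  rw [hD.fderiv] at hinj
  -- Zeros over `ξ` form a translate of `ker Ψ`, so uniqueness of `μ` is injectivity of `Ψ`. Both
  -- sides have dimension `(n - κ) + 1`, hence `Ψ` is onto.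
  set Ψ : (Fin (n - breadth f ξ + 1) → ℂ) →ₗ[ℂ] LinearMap.range J.mulVecLin × ℂ :=
    (J.mulVecLin.rangeRestrict ∘ₗ (Matrix.of B).mulVecLin).prod (dotProductBilin ℂ ℂ b) with hΨ
  have hΨinj : Function.Injective Ψ := by
    rw [injective_iff_map_eq_zero]
    intro q hq
    have hq1 : J *ᵥ (Matrix.of B *ᵥ q) = 0 := congrArg (fun r => (r.1 : Fin n → ℂ)) hq
    have hq2 : b ⬝ᵥ q = 0 := congrArg Prod.snd hq
    have := huniq (μ + q) ⟨h0, by rw [Matrix.mulVec_add, Matrix.mulVec_add, hJμ, hq1, add_zero],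
      by rw [dotProduct_add, hq2, add_zero, hbμ]⟩
    simpa using this
  have hrank : Module.finrank ℂ (Fin (n - breadth f ξ + 1) → ℂ) =
      Module.finrank ℂ (LinearMap.range J.mulVecLin × ℂ) := by
    have h1 := J.mulVecLin.finrank_range_add_finrank_ker
    have h2 : breadth f ξ = Module.finrank ℂ (LinearMap.ker J.mulVecLin) := rfl
    rw [Module.finrank_fin_fun] at h1
    rw [Module.finrank_fin_fun, Module.finrank_prod, Module.finrank_self]
    omega
  have hΨsurj := (LinearMap.injective_iff_surjective_of_finrank_eq_finrank hrank).1 hΨinj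
  refine ⟨WithLp.toLp 2 (Matrix.of B *ᵥ μ), ?_, fun w u hw hwu => ?_⟩
  · rw [fderiv_sysMap_apply]
    exact congrArg (WithLp.toLp 2) hJμ
  · rw [fderiv_fderiv_sysMap_apply, fderiv_sysMap_apply] at hwu
    rw [fderiv_sysMap_apply] at hw
    have hwu := congrArg WithLp.ofLp hwu
    have hw := congrArg WithLp.ofLp hw
    simp only at hw hwu
    rw [sysHessian_mulVec_comm] at hwu
    -- This `q` cancels `J u`, which puts `(w, q)` in the kernel of the deflated Jacobian;
    -- regularity of the zero forces `w = 0`.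
    obtain ⟨q, hq⟩ := hΨsurj (-⟨J *ᵥ u, ⟨u, rfl⟩⟩, 0)
    have hq1 : J *ᵥ (Matrix.of B *ᵥ q) = -(J *ᵥ u) :=
      congrArg (fun r => (r.1 : Fin n → ℂ)) hq
    have hq2 : b ⬝ᵥ q = 0 := congrArg Prod.snd hq
    have hker : D (w.ofLp, q) = 0 := by
      rw [hDq]
      refine Prod.ext hw (Prod.ext ?_ hq2)
      simp only [← hJ, hq1]
      rw [hwu]
      exact add_neg_cancel _
    have := congrArg Prod.fst ((injective_iff_map_eq_zero D).1 hinj _ hker)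
    exact congrArg (WithLp.toLp 2) this

end Deflation

/-! ### Assembly: convergence and random samples -/

section Newton

variable {n : ℕ} (f : Fin n → MvPolynomial (Fin n) ℂ)

theorem fderiv_sysMap_toLinearMap (x : EuclideanSpace ℂ (Fin n)) :
    (fderiv ℂ (sysMap f) x).toLinearMap = Matrix.toEuclideanLin (sysJacobian f x) :=
  LinearMap.ext fun w => fderiv_sysMap_apply f x w

theorem finrank_ker_fderiv_sysMap (ξ : EuclideanSpace ℂ (Fin n)) :
    Module.finrank ℂ (LinearMap.ker (fderiv ℂ (sysMap f) ξ).toLinearMap) = breadth f ξ := by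
  have h : LinearMap.ker (fderiv ℂ (sysMap f) ξ).toLinearMap =
      (LinearMap.ker (sysJacobian f ξ).mulVecLin).comap
        (WithLp.linearEquiv 2 ℂ (Fin n → ℂ)).toLinearMap := by
    ext w
    rw [LinearMap.mem_ker, Submodule.mem_comap, LinearMap.mem_ker]
    change fderiv ℂ (sysMap f) ξ w = 0 ↔ _
    rw [fderiv_sysMap_apply]
    exact ⟨fun h => congrArg WithLp.ofLp h, fun h => congrArg (WithLp.toLp 2) h⟩
  rw [h]
  exact (LinearEquiv.ofSubmodule' (WithLp.linearEquiv 2 ℂ (Fin n → ℂ)) _).finrank_eq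

theorem isGenericAtLevel_iff (ξ v : EuclideanSpace ℂ (Fin n)) (γ : ℝ) :
    IsGenericAtLevel f ξ γ v ↔
      GenericVector (fderiv ℂ (sysMap f) ξ) (fderiv ℂ (fderiv ℂ (sysMap f)) ξ) γ v := by
  constructor
  · intro h w u hw
    rw [fderiv_fderiv_sysMap_apply, fderiv_sysMap_apply]
    rw [fderiv_sysMap_apply] at hw
    exact h w u (congrArg WithLp.ofLp hw)
  · intro h w u hw
    have := h (WithLp.toLp 2 w) (WithLp.toLp 2 u)
      (by rw [fderiv_sysMap_apply]; exact congrArg (WithLp.toLp 2) hw)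
    rwa [fderiv_fderiv_sysMap_apply, fderiv_sysMap_apply] at this

section Step

variable (τ : ℝ) (U : Matrix (Fin n) (Fin n) ℂ) (σ : Fin n → ℝ) (V : Matrix (Fin n) (Fin n) ℂ)
  (x : EuclideanSpace ℂ (Fin n)) (z : EuclideanSpace ℂ (TailIdx τ σ))

/-- The truncated pseudo-inverse of the first refinement. -/
def truncatedInverse : EuclideanSpace ℂ (Fin n) →ₗ[ℂ] EuclideanSpace ℂ (Fin n) :=
  Matrix.toEuclideanLin (leadBlock τ σ V *
    (Matrix.diagonal fun i : LeadIdx τ σ => (σ i : ℂ))⁻¹ * (leadBlock τ σ U)ᴴ)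

theorem sampleVec_eq :
    sampleVec τ σ V z = (Matrix.toEuclideanLin (tailBlock τ σ V) z).ofLp := rfl

theorem toEuclideanLin_stepMatrix (y : EuclideanSpace ℂ (TailIdx τ σ)) :
    Matrix.toEuclideanLin (stepMatrix f τ U σ V x z) y =
      Matrix.toEuclideanLin (tailBlock τ σ U)ᴴ
        (fderiv ℂ (fderiv ℂ (sysMap f)) (x - truncatedInverse τ U σ V (sysMap f x))
          (Matrix.toEuclideanLin (tailBlock τ σ V) z)
          (Matrix.toEuclideanLin (tailBlock τ σ V) y)) := by
  rw [fderiv_fderiv_sysMap_apply, stepMatrix, Matrix.toEuclideanLin_mul_apply,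
    Matrix.toEuclideanLin_mul_apply]
  rfl

theorem isUnit_stepMatrix_iff : IsUnit (stepMatrix f τ U σ V x z) ↔
    Function.Injective (Matrix.toEuclideanLin (stepMatrix f τ U σ V x z)) := by
  rw [← Matrix.mulVec_injective_iff_isUnit]
  constructor
  · intro h y y' hyy'
    exact WithLp.ofLp_injective 2 (h (congrArg WithLp.ofLp hyy'))
  · intro h y y' hyy'
    exact WithLp.toLp_injective 2 (h (congrArg (WithLp.toLp 2) hyy'))

end Step

theorem eventually_mul_norm_sub_lt {E : Type*} [NormedAddCommGroup E] (ξ : E) (c : ℝ) {d : ℝ}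
    (hd : 0 < d) : ∀ᶠ x in 𝓝 ξ, c * ‖x - ξ‖ < d := by
  have h : Continuous fun x : E => c * ‖x - ξ‖ := by fun_prop
  exact h.continuousAt.eventually_lt continuousAt_const (by simpa using hd)

variable {f} {ξ : EuclideanSpace ℂ (Fin n)} {L ρ s₀ τ γ : ℝ}

/-- Near `ξ`, every singular value decomposition splits the Jacobian at the numerical rank
`n - κ`, with bounds independent of the tolerance. -/
theorem eventually_truncatedSplitting (hT : TaylorBound (sysMap f) ξ L ρ) (hs₀ : 0 < s₀)
    (hs : ∀ w ∈ (LinearMap.ker (fderiv ℂ (sysMap f) ξ).toLinearMap)ᗮ,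
      s₀ * ‖w‖ ≤ ‖fderiv ℂ (sysMap f) ξ w‖)
    (hτ : IsAdmissibleTolerance f ξ τ) :
    ∀ᶠ x : EuclideanSpace ℂ (Fin n) in 𝓝 ξ, ∀ U σ V, IsSVD (sysJacobian f x) U σ V →
      Fintype.card (TailIdx τ σ) = breadth f ξ ∧
      TruncatedSplitting (fderiv ℂ (sysMap f) x) (L * ‖x - ξ‖) (s₀ / 2)⁻¹
        (Matrix.toEuclideanLin (tailBlock τ σ U)) (Matrix.toEuclideanLin (tailBlock τ σ V))
        (Matrix.toEuclideanLin (tailBlock τ σ U)ᴴ) (Matrix.toEuclideanLin (tailBlock τ σ V)ᴴ)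
        (truncatedInverse τ U σ V) := by
  obtain ⟨s, hτs, hs'⟩ := LinearMap.exists_lt_le_norm_of_lt_singularValues _ hτ.1.le hτ.2
  filter_upwards [Metric.ball_mem_nhds ξ hT.pos, eventually_mul_norm_sub_lt ξ L hτ.1,
    eventually_mul_norm_sub_lt ξ L (sub_pos.2 hτs),
    eventually_mul_norm_sub_lt ξ L (half_pos hs₀)] with x hx h1 h2 h3 U σ V hsvd
  have hL := hT.one_le
  have hε : 0 ≤ L * ‖x - ξ‖ := by positivity
  have hA : ∀ w, ‖Matrix.toEuclideanLin (sysJacobian f x) w -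
      Matrix.toEuclideanLin (sysJacobian f ξ) w‖ ≤ L * ‖x - ξ‖ * ‖w‖ := by
    intro w
    have := ContinuousLinearMap.le_of_opNorm_le _ (hT.jac x hx) w
    rwa [sub_apply, fderiv_sysMap_apply, fderiv_sysMap_apply] at this
  have hs'' : ∀ w ∈ (LinearMap.ker (Matrix.toEuclideanLin (sysJacobian f ξ)))ᗮ,
      s₀ * ‖w‖ ≤ ‖Matrix.toEuclideanLin (sysJacobian f ξ) w‖ := by
    intro w hw
    rw [← fderiv_sysMap_toLinearMap] at hw ⊢
    exact hs w hw
  refine ⟨?_, hsvd.truncatedSplitting (fderiv_sysMap_apply f x) hτ.1.le hε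
    (inv_pos.2 (half_pos hs₀))
    (fun i hi => hsvd.tail_le hA hs' hε h1 (by linarith) hi)
    (fun i hi => ?_)⟩
  · rw [hsvd.card_tailIdx hA hs' hε h1 (by linarith), ← fderiv_sysMap_toLinearMap,
      finrank_ker_fderiv_sysMap]
  · rw [inv_inv]
    exact hsvd.le_lead hA hs' hε h1 (by linarith) hs'' h3 hi

variable (f ξ) in
/-- The Jacobian at `ξ` is bounded below on the complement of its kernel. -/
theorem exists_le_norm_fderiv_sysMap : ∃ s₀, 0 < s₀ ∧
    ∀ w ∈ (LinearMap.ker (fderiv ℂ (sysMap f) ξ).toLinearMap)ᗮ,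
      s₀ * ‖w‖ ≤ ‖fderiv ℂ (sysMap f) ξ w‖ :=
  LinearMap.exists_lt_le_norm_of_lt_singularValues (fderiv ℂ (sysMap f) ξ).toLinearMap le_rfl
    fun i hi => (LinearMap.singularValues_pos_iff_ne_zero _ i).2 hi

/-- Halving `s₀` lets one constant `g = (s₀/2)⁻¹` serve both `ξ` and the leading singular values at
nearby `x`. -/
theorem norm_le_inv_mul {E : Type*} [NormedAddCommGroup E] {T : E → E} {S : Set E} (hs₀ : 0 < s₀)
    (hs : ∀ w ∈ S, s₀ * ‖w‖ ≤ ‖T w‖) : ∀ w ∈ S, ‖w‖ ≤ (s₀ / 2)⁻¹ * ‖T w‖ := by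
  intro w hw
  rw [← div_eq_inv_mul, le_div_iff₀ (half_pos hs₀)]
  nlinarith [hs w hw, norm_nonneg w]

variable (f ξ) in
/-- Near `ξ` the matrix of the second step is invertible and one step squares the error. -/
theorem exists_eventually_step (h0 : sysEval f ξ = 0) (hγ : 0 < γ) :
    ∃ C : ℝ, 0 < C ∧ ∀ τ, IsAdmissibleTolerance f ξ τ →
      ∀ᶠ x : EuclideanSpace ℂ (Fin n) in 𝓝 ξ, ∀ U σ V, IsSVD (sysJacobian f x) U σ V →
        Fintype.card (TailIdx τ σ) = breadth f ξ ∧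
        ∀ z : EuclideanSpace ℂ (TailIdx τ σ), ‖z‖ = 1 →
          IsGenericAtLevel f ξ γ (sampleVec τ σ V z) →
          IsUnit (stepMatrix f τ U σ V x z) ∧
          ∀ x'', IsTwoStepOutput f τ U σ V x z x'' → ‖x'' - ξ‖ ≤ C * ‖x - ξ‖ ^ 2 := by
  obtain ⟨L, ρ, hT⟩ := (sysMap_contDiff f).exists_taylorBound ξ
  obtain ⟨s₀, hs₀, hs⟩ := exists_le_norm_fderiv_sysMap f ξ
  have hL := hT.one_le
  refine ⟨(s₀ / 2)⁻¹ * L + 2 / γ * ((s₀ / 2)⁻¹ * L * L + 4 * L + 4 * (s₀ / 2)⁻¹ * L ^ 2),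
    by positivity, fun τ hτ => ?_⟩
  set g := (s₀ / 2)⁻¹ with hgdef
  have hg : 0 ≤ g := (inv_pos.2 (half_pos hs₀)).le
  have hF0 : sysMap f ξ = 0 := congrArg (WithLp.toLp 2) h0
  have hs' := norm_le_inv_mul (T := fderiv ℂ (sysMap f) ξ)
    (S := ((LinearMap.ker (fderiv ℂ (sysMap f) ξ).toLinearMap)ᗮ : Set _)) hs₀ hs
  filter_upwards [eventually_truncatedSplitting hT hs₀ hs hτ,
    eventually_mul_norm_sub_lt ξ 2 hT.pos, eventually_mul_norm_sub_lt ξ (g * L) one_pos,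
    eventually_mul_norm_sub_lt ξ (2 * γ * g * L + 3 * g * L * L + 2 * L) (half_pos hγ)]
    with x hx h1 h2 h3 U σ V hsvd
  obtain ⟨hcard, sp⟩ := hx U σ V hsvd
  refine ⟨hcard, fun z hz hgen => ⟨?_, ?_⟩⟩
  · rw [sampleVec_eq, isGenericAtLevel_iff] at hgen
    rw [isUnit_stepMatrix_iff, injective_iff_map_eq_zero]
    intro y hy
    have := norm_secondStep_ge hT hF0 hg hγ hs' h1 h2.le h3.le sp (by rw [sp.norm_V, hz]) hgen y
    rw [← toEuclideanLin_stepMatrix, hy, norm_zero] at this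
    exact norm_le_zero_iff.1 (by nlinarith)
  · rintro x'' ⟨δ, hδ, rfl⟩
    rw [sampleVec_eq, isGenericAtLevel_iff] at hgen
    refine norm_twoStep_le hT hF0 hg hγ hs' h1 h2.le h3.le sp hz hgen (δ := WithLp.toLp 2 δ) ?_
    rw [← toEuclideanLin_stepMatrix, fderiv_sysMap_apply]
    exact congrArg (WithLp.toLp 2) hδ

/-- A sequence that starts close to `ξ` and squares its distance to `ξ` in every step converges to
`ξ`. -/
theorem quadratic_convergence {E : Type*} [NormedAddCommGroup E] {ξ : E} {X : ℕ → E} {C r : ℝ}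
    (hCr : C * r ≤ 1 / 2) (hC : 0 ≤ C) (h0 : X 0 ∈ Metric.ball ξ r)
    (h : ∀ k, X k ∈ Metric.ball ξ r → ‖X (k + 1) - ξ‖ ≤ C * ‖X k - ξ‖ ^ 2) :
    (∀ k, X k ∈ Metric.ball ξ r) ∧ (∀ k, ‖X (k + 1) - ξ‖ ≤ C * ‖X k - ξ‖ ^ 2) ∧
      Tendsto X atTop (𝓝 ξ) := by
  have hhalf : ∀ k, X k ∈ Metric.ball ξ r → ‖X (k + 1) - ξ‖ ≤ 1 / 2 * ‖X k - ξ‖ := by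
    intro k hk
    refine (h k hk).trans ?_
    rw [mem_ball_iff_norm] at hk
    have h1 : C * ‖X k - ξ‖ ≤ 1 / 2 := (mul_le_mul_of_nonneg_left hk.le hC).trans hCr
    nlinarith [norm_nonneg (X k - ξ)]
  have hball : ∀ k, X k ∈ Metric.ball ξ r := by
    intro k
    induction k with
    | zero => exact h0
    | succ k ih =>
      have h1 := hhalf k ih
      rw [mem_ball_iff_norm] at ih ⊢
      linarith [norm_nonneg (X k - ξ)]
  refine ⟨hball, fun k => h k (hball k), ?_⟩
  have hgeom : ∀ k, ‖X k - ξ‖ ≤ (1 / 2) ^ k * ‖X 0 - ξ‖ := by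
    intro k
    induction k with
    | zero => simp
    | succ k ih =>
      have := hhalf k (hball k)
      rw [pow_succ]
      linarith
  rw [tendsto_iff_norm_sub_tendsto_zero]
  refine squeeze_zero (fun k => norm_nonneg _) hgeom ?_
  simpa using (tendsto_pow_atTop_nhds_zero_of_lt_one (by norm_num : (0 : ℝ) ≤ 1 / 2)
    (by norm_num)).mul_const ‖X 0 - ξ‖

/-- Local quadratic convergence with generic samples. -/
theorem twoStepNewton_quadratic (h0 : sysEval f ξ = 0) (hγ : 0 < γ) :
    ∃ C : ℝ, 0 < C ∧
      ∀ τ : ℝ, IsAdmissibleTolerance f ξ τ → ∃ r : ℝ, 0 < r ∧ r < 1 ∧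
        (∀ x ∈ Metric.ball ξ r, ∀ U σ V, IsSVD (sysJacobian f x) U σ V →
          Fintype.card (TailIdx τ σ) = breadth f ξ ∧
          ∀ z : EuclideanSpace ℂ (TailIdx τ σ), ‖z‖ = 1 →
            IsGenericAtLevel f ξ γ (sampleVec τ σ V z) →
            IsUnit (stepMatrix f τ U σ V x z) ∧
            ∀ x'', IsTwoStepOutput f τ U σ V x z x'' → ‖x'' - ξ‖ ≤ C * ‖x - ξ‖ ^ 2) ∧
        (∀ X : ℕ → EuclideanSpace ℂ (Fin n), X 0 ∈ Metric.ball ξ r →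
          (∀ k, TwoStepNewton f τ (IsGenericAtLevel f ξ γ) (X k) (X (k + 1))) →
          (∀ k, X k ∈ Metric.ball ξ r) ∧
          (∀ k, ‖X (k + 1) - ξ‖ ≤ C * ‖X k - ξ‖ ^ 2) ∧
          Tendsto X atTop (𝓝 ξ)) := by
  obtain ⟨C, hC, hstep⟩ := exists_eventually_step f ξ h0 hγ
  refine ⟨C, hC, fun τ hτ => ?_⟩
  obtain ⟨r₀, hr₀, hr⟩ := Metric.eventually_nhds_iff_ball.1 (hstep τ hτ)
  have hrr₀ : Metric.ball ξ (min r₀ (min (1 / 2) (1 / 2 / C))) ⊆ Metric.ball ξ r₀ :=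
    Metric.ball_subset_ball (min_le_left _ _)
  -- The bound `1 / 2 / C` makes every step at least halve the error, and `1 / 2` keeps the radius
  -- below one.
  refine ⟨min r₀ (min (1 / 2) (1 / 2 / C)), by positivity,
    ((min_le_right _ _).trans (min_le_left _ _)).trans_lt (by norm_num),
    fun x hx => hr x (hrr₀ hx), fun X hX0 hX => ?_⟩
  refine quadratic_convergence ?_ hC.le hX0 fun k hk => ?_
  · have : min r₀ (min (1 / 2) (1 / 2 / C)) ≤ 1 / 2 / C :=
      (min_le_right _ _).trans (min_le_right _ _)
    rwa [le_div_iff₀ hC, mul_comm] at this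
  · obtain ⟨U, σ, V, hsvd, z, hz, hgen, hout⟩ := hX k
    exact ((hr _ (hrr₀ hk) U σ V hsvd).2 z hz hgen).2 _ hout

/-- A random sample is generic at a uniform level with probability close to one. -/
theorem exists_level_sphereMeasure_le (hξ : IsDeflationOneSingularZero f ξ) {η : ℝ} (hη : 0 < η) :
    ∃ γ : ℝ, 0 < γ ∧ ∀ τ : ℝ, IsAdmissibleTolerance f ξ τ → ∃ r : ℝ, 0 < r ∧
      ∀ x ∈ Metric.ball ξ r, ∀ U σ V, IsSVD (sysJacobian f x) U σ V →
        sphereMeasure (TailIdx τ σ) {z | ¬ IsGenericAtLevel f ξ γ (sampleVec τ σ V z)} ≤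
          ENNReal.ofReal η * sphereMeasure (TailIdx τ σ) Set.univ := by
  obtain ⟨L, ρ, hT⟩ := (sysMap_contDiff f).exists_taylorBound ξ
  obtain ⟨s₀, hs₀, hs⟩ := exists_le_norm_fderiv_sysMap f ξ
  obtain ⟨v₀, hv₀, hinj⟩ := hξ.exists_kernel_vector
  set A₀ := fderiv ℂ (sysMap f) ξ with hA₀
  set H := fderiv ℂ (fderiv ℂ (sysMap f)) ξ with hH
  set g := (s₀ / 2)⁻¹ with hgdef
  have hg : 0 ≤ g := (inv_pos.2 (half_pos hs₀)).le
  have hs' := norm_le_inv_mul (T := A₀)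
    (S := ((LinearMap.ker A₀.toLinearMap)ᗮ : Set _)) hs₀ hs
  set ν : Measure (LinearMap.ker A₀.toLinearMap) := Measure.addHaar with hν
  obtain ⟨γ, hγ, hγν⟩ := exists_level_measure_le hv₀ (injective_kernelCompression hinj) ν
    (c := ENNReal.ofReal η * ν (Metric.ball 0 (1 / 2)))
    (ENNReal.mul_pos (ENNReal.ofReal_pos.2 hη).ne'
      (Metric.measure_ball_pos ν 0 (by norm_num)).ne')
  -- Half the level is given up in passing from kernel vectors to samples.
  refine ⟨γ / 2, half_pos hγ, fun τ hτ => ?_⟩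
  have hev : ∀ᶠ x : EuclideanSpace ℂ (Fin n) in 𝓝 ξ, ∀ U σ V, IsSVD (sysJacobian f x) U σ V →
      sphereMeasure (TailIdx τ σ) {z | ¬ IsGenericAtLevel f ξ (γ / 2) (sampleVec τ σ V z)} ≤
        ENNReal.ofReal η * sphereMeasure (TailIdx τ σ) Set.univ := by
    filter_upwards [eventually_truncatedSplitting hT hs₀ hs hτ, Metric.ball_mem_nhds ξ hT.pos,
      eventually_mul_norm_sub_lt ξ (2 * g * L) (half_pos one_pos),
      eventually_mul_norm_sub_lt ξ (‖H‖ * (2 * g * L)) (half_pos hγ)] with x hx hxρ h1 h2 U σ V hsvd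
    obtain ⟨hcard, sp⟩ := hx U σ V hsvd
    simp only [sampleVec_eq, isGenericAtLevel_iff]
    refine sp.toSphere_not_generic_le (hT.jac x hxρ) hg hs' (by linarith) ?_ (half_pos hγ).le
      (by linarith) ν ?_ volume
    · rw [finrank_euclideanSpace, hcard, finrank_ker_fderiv_sysMap]
    · rwa [mul_div_cancel₀ γ two_ne_zero]
  exact Metric.eventually_nhds_iff_ball.1 hev

/-- Near `ξ`, almost every sample makes the matrix of the second step invertible. -/
theorem exists_ball_ae_isUnit_stepMatrix (hξ : IsDeflationOneSingularZero f ξ)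
    (hτ : IsAdmissibleTolerance f ξ τ) :
    ∃ r : ℝ, 0 < r ∧ ∀ x ∈ Metric.ball ξ r, ∀ U σ V, IsSVD (sysJacobian f x) U σ V →
      ∀ᵐ z : Metric.sphere (0 : EuclideanSpace ℂ (TailIdx τ σ)) 1 ∂(sphereMeasure (TailIdx τ σ)),
        IsUnit (stepMatrix f τ U σ V x z) := by
  -- Any failure probability below one would do: only one generic sample is needed.
  obtain ⟨γ, hγ, hlevel⟩ := exists_level_sphereMeasure_le hξ (η := 1 / 2) (by norm_num)
  obtain ⟨r₁, hr₁, hgen⟩ := hlevel τ hτ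
  obtain ⟨C, -, hstep⟩ := exists_eventually_step f ξ hξ.1.1 hγ
  obtain ⟨r₂, hr₂, hunit⟩ := Metric.eventually_nhds_iff_ball.1 (hstep τ hτ)
  refine ⟨min r₁ r₂, lt_min hr₁ hr₂, fun x hx U σ V hsvd => ?_⟩
  have hgen := hgen x (Metric.ball_subset_ball (min_le_left _ _) hx) U σ V hsvd
  have hunit := (hunit x (Metric.ball_subset_ball (min_le_right _ _) hx) U σ V hsvd).2
  by_cases hzero : sphereMeasure (TailIdx τ σ) = 0
  · rw [hzero]
    exact ae_zero.symm ▸ eventually_bot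
  obtain ⟨z₀, hz₀⟩ : ∃ z : Metric.sphere (0 : EuclideanSpace ℂ (TailIdx τ σ)) 1,
      IsGenericAtLevel f ξ γ (sampleVec τ σ V z) := by
    by_contra! hall
    have : {z : Metric.sphere (0 : EuclideanSpace ℂ (TailIdx τ σ)) 1 |
        ¬ IsGenericAtLevel f ξ γ (sampleVec τ σ V z)} = Set.univ := Set.eq_univ_of_forall hall
    rw [this] at hgen
    have hfin : sphereMeasure (TailIdx τ σ) Set.univ ≠ ⊤ :=
      measure_ne_top (volume : Measure (EuclideanSpace ℂ (TailIdx τ σ))).toSphere _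
    have hpos : 0 < sphereMeasure (TailIdx τ σ) Set.univ :=
      pos_iff_ne_zero.2 (Measure.measure_univ_ne_zero.2 hzero)
    have hlt : ENNReal.ofReal (1 / 2) < 1 := by
      rw [ENNReal.ofReal_lt_one]; norm_num
    have := ENNReal.mul_lt_mul_left hpos.ne' hfin hlt
    rw [one_mul] at this
    exact absurd hgen (not_le.2 this)
  -- `B'` is linear in the sample because `x'` does not depend on it.
  set N : EuclideanSpace ℂ (TailIdx τ σ) →L[ℂ] EuclideanSpace ℂ (TailIdx τ σ) →L[ℂ]
      EuclideanSpace ℂ (TailIdx τ σ) :=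
    (ContinuousLinearMap.compL ℂ _ _ _
      (Matrix.toEuclideanLin (tailBlock τ σ U)ᴴ).toContinuousLinearMap) ∘L
    ((ContinuousLinearMap.compL ℂ _ _ _).flip
      (Matrix.toEuclideanLin (tailBlock τ σ V)).toContinuousLinearMap) ∘L
    (fderiv ℂ (fderiv ℂ (sysMap f)) (x - truncatedInverse τ U σ V (sysMap f x))) ∘L
    (Matrix.toEuclideanLin (tailBlock τ σ V)).toContinuousLinearMap with hN
  have hNapply : ∀ z y, N z y = Matrix.toEuclideanLin (stepMatrix f τ U σ V x z) y :=
    fun z y => (toEuclideanLin_stepMatrix f τ U σ V x z y).symm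
  have hiff : ∀ z : EuclideanSpace ℂ (TailIdx τ σ),
      IsUnit (stepMatrix f τ U σ V x z) ↔ Function.Injective (N z) := fun z => by
    rw [isUnit_stepMatrix_iff, funext (hNapply z)]
  simp only [hiff]
  refine Measure.ae_toSphere (p := fun z => Function.Injective (N z))
    (ContinuousLinearMap.isOpen_injective.preimage N.continuous).measurableSet ?_
    (N.ae_injective rfl ((hiff z₀).1 (hunit z₀ (norm_eq_of_mem_sphere z₀) hz₀).1) volume)
  intro t _ z hinj
  rw [injective_iff_map_eq_zero] at hinj ⊢
  intro y hy
  refine hinj y ?_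
  rw [← algebraMap_smul ℂ t z, map_smul, smul_apply, hy, smul_zero]

end Newton

end

theorem theorem12 {n : ℕ} (f : Fin n → MvPolynomial (Fin n) ℂ) (ξ : EuclideanSpace ℂ (Fin n))
    (hξ : IsDeflationOneSingularZero f ξ) :
    -- quadratic convergence, one step and iterated, with uniformly generic samples
    (∀ γ : ℝ, 0 < γ → ∃ C : ℝ, 0 < C ∧
      ∀ τ : ℝ, IsAdmissibleTolerance f ξ τ → ∃ r : ℝ, 0 < r ∧ r < 1 ∧
        (∀ x ∈ Metric.ball ξ r, ∀ U σ V, IsSVD (sysJacobian f x) U σ V →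
          Fintype.card (TailIdx τ σ) = breadth f ξ ∧
          ∀ z : EuclideanSpace ℂ (TailIdx τ σ), ‖z‖ = 1 →
            IsGenericAtLevel f ξ γ (sampleVec τ σ V z) →
            IsUnit (stepMatrix f τ U σ V x z) ∧
            ∀ x'', IsTwoStepOutput f τ U σ V x z x'' → ‖x'' - ξ‖ ≤ C * ‖x - ξ‖ ^ 2) ∧
        (∀ X : ℕ → EuclideanSpace ℂ (Fin n), X 0 ∈ Metric.ball ξ r →
          (∀ k, TwoStepNewton f τ (IsGenericAtLevel f ξ γ) (X k) (X (k + 1))) →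
          (∀ k, X k ∈ Metric.ball ξ r) ∧
          (∀ k, ‖X (k + 1) - ξ‖ ≤ C * ‖X k - ξ‖ ^ 2) ∧
          Tendsto X atTop (𝓝 ξ))) ∧
    -- a random sample is generic at a uniform level with probability close to one
    (∀ η : ℝ, 0 < η → ∃ γ : ℝ, 0 < γ ∧
      ∀ τ : ℝ, IsAdmissibleTolerance f ξ τ → ∃ r : ℝ, 0 < r ∧
        ∀ x ∈ Metric.ball ξ r, ∀ U σ V, IsSVD (sysJacobian f x) U σ V →
          sphereMeasure (TailIdx τ σ) {z | ¬ IsGenericAtLevel f ξ γ (sampleVec τ σ V z)} ≤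
            ENNReal.ofReal η * sphereMeasure (TailIdx τ σ) Set.univ) ∧
    -- near `ξ`, almost every sample makes the matrix of the second step invertible
    (∀ τ : ℝ, IsAdmissibleTolerance f ξ τ → ∃ r : ℝ, 0 < r ∧
      ∀ x ∈ Metric.ball ξ r, ∀ U σ V, IsSVD (sysJacobian f x) U σ V →
        ∀ᵐ z : Metric.sphere (0 : EuclideanSpace ℂ (TailIdx τ σ)) 1 ∂(sphereMeasure (TailIdx τ σ)),
          IsUnit (stepMatrix f τ U σ V x z)) := by
  exact ⟨fun _ hγ => twoStepNewton_quadratic hξ.1.1 hγ,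
    fun _ hη => exists_level_sphereMeasure_le hξ hη,
    fun _ hτ => exists_ball_ae_isUnit_stepMatrix hξ hτ⟩
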